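/- Let $d\ge 1$ and $m\ge 0$ be integers, with $m\le 1$ if $d=1$ (so that non-zero harmonic homogeneous polynomials of degree $m$ in $d$ variables exist), and let $c>0$. Let $\mathbb B^d=\{x\in\mathbb R^d:\|x\|\le 1\}$ and consider the Sturm–Liouville operator $$\mathcal L_c\psi=-\nabla\cdot\big((1-\|x\|^2)\nabla\psi\big)-\Delta_0\psi+c^2\|x\|^2\psi,\qquad \Delta_0=\sum_{1\le j<i\le d}(x_j\partial_{x_i}-x_i\partial_{x_j})^2 .$$ Call $\chi\in\mathbb R$ an eigenvalue of $\mathcal L_c$ of angular order $m$ if there is a function $\psi\not\equiv 0$ on $\mathbb B^d$, twice continuously differentiable up to the boundary, of the form $\psi(x)=\varphi(2\|x\|^2-1)\,H(x)$ with $\varphi:[-1,1]\to\mathbb R$ and $H$ a harmonic homogeneous polynomial of degree $m$, such that $\mathcal L_c\psi=\chi\psi$ for $\|x\|<1$. Then these eigenvalues form a strictly increasing sequence $\chi^{(m)}_0(c)<\chi^{(m)}_1(c)<\cdots$, and for every integer $k\ge 0$ $$(m+2k)(m+2k+d)\;\le\;\chi^{(m)}_k(c)\;\le\;(m+2k)(m+2k+d)+c^2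 .$$ -/

import Mathlib

namespace BallPSWF

/-- The `i`-th partial derivative `∂f/∂xᵢ` of a real function on `ℝᵈ`. -/
noncomputable def pd {d : ℕ} (i : Fin d) (f : EuclideanSpace ℝ (Fin d) → ℝ)
    (x : EuclideanSpace ℝ (Fin d)) : ℝ :=
  fderiv ℝ f x (EuclideanSpace.single i 1)

/-- The angular derivative `D_{ij} = xⱼ ∂ᵢ - xᵢ ∂ⱼ`. -/
noncomputable def angularD {d : ℕ} (i j : Fin d) (f : EuclideanSpace ℝ (Fin d) → ℝ)
    (x : EuclideanSpace ℝ (Fin d)) : ℝ :=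
  x j * pd i f x - x i * pd j f x

/-- The angular part of the Laplacian (Laplace–Beltrami operator on spheres),
`Δ₀ = ∑_{j < i} D_{ij}²`. -/
noncomputable def angularLaplacian {d : ℕ} (f : EuclideanSpace ℝ (Fin d) → ℝ)
    (x : EuclideanSpace ℝ (Fin d)) : ℝ :=
  ∑ i : Fin d, ∑ j ∈ Finset.univ.filter (fun j : Fin d => j < i),
    angularD i j (angularD i j f) x

/-- The Sturm–Liouville operator
`L_c f = -∇·((1 - ‖x‖²) ∇f) - Δ₀ f + c² ‖x‖² f`. -/
noncomputable def sturmLiouville {d : ℕ} (c : ℝ) (f : EuclideanSpace ℝ (Fin d) → ℝ)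
    (x : EuclideanSpace ℝ (Fin d)) : ℝ :=
  -(∑ i : Fin d, pd i (fun y => (1 - ‖y‖ ^ 2) * pd i f y) x)
    - angularLaplacian f x + c ^ 2 * ‖x‖ ^ 2 * f x

/-- `H` is a harmonic homogeneous polynomial of degree `m` in `d` variables; its restriction
to the unit sphere is a spherical harmonic of degree `m`. -/
def IsHarmonicHomogeneous {d : ℕ} (m : ℕ) (H : MvPolynomial (Fin d) ℝ) : Prop :=
  H.IsHomogeneous m ∧ ∑ i : Fin d, MvPolynomial.pderiv i (MvPolynomial.pderiv i H) = 0

/-- On the closed unit ball, `ψ` has the separated form `ψ(x) = ‖x‖ᵐ φ(2‖x‖² - 1) Y(x/‖x‖)`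
with `Y` a spherical harmonic of degree `m`. If `Y` is the restriction of the harmonic
homogeneous polynomial `H`, then `‖x‖ᵐ Y(x/‖x‖) = H(x)`. -/
def IsSeparated {d : ℕ} (m : ℕ) (ψ : EuclideanSpace ℝ (Fin d) → ℝ) : Prop :=
  ∃ (φ : ℝ → ℝ) (H : MvPolynomial (Fin d) ℝ), IsHarmonicHomogeneous m H ∧
    ∀ x ∈ Metric.closedBall (0 : EuclideanSpace ℝ (Fin d)) 1,
      ψ x = φ (2 * ‖x‖ ^ 2 - 1) * MvPolynomial.eval (fun i => x i) H

/-- `ψ` is an eigenfunction of `L_c` on the unit ball, of angular order `m`, with eigenvalue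
`χ`. It is required to be `C²` up to the boundary, which singles out the self-adjoint
realisation of `L_c` (no further boundary condition is needed, as `1 - ‖x‖²` vanishes on the
unit sphere; the solutions that are excluded are singular there, or at the origin). -/
def IsEigenfunction (d m : ℕ) (c χ : ℝ) (ψ : EuclideanSpace ℝ (Fin d) → ℝ) : Prop :=
  ContDiffOn ℝ 2 ψ (Metric.closedBall 0 1) ∧
  IsSeparated m ψ ∧
  (∃ x ∈ Metric.closedBall (0 : EuclideanSpace ℝ (Fin d)) 1, ψ x ≠ 0) ∧
  ∀ x ∈ Metric.ball (0 : EuclideanSpace ℝ (Fin d)) 1, sturmLiouville c ψ x = χ * ψ x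

/-- The set of eigenvalues of `L_c` of angular order `m`. -/
def eigenvalues (d m : ℕ) (c : ℝ) : Set ℝ :=
  {χ : ℝ | ∃ ψ, IsEigenfunction d m c χ ψ}

end BallPSWF

/-! Put `b = d/2 + m`. On functions `G(‖x‖²) H(x)` with `H` harmonic and homogeneous of degree `m`,
the operator acts on the radial factor alone: it becomes `-4 (t (1 - t) G'' + (b - (b + 1) t) G') +
c² t G + m (m + d) G` in `t = ‖x‖²` (`sturmLiouville_radialMul`). For `c = 0` this is a Jacobi
operator shifted by `m (m + d)`, with eigenvalues `4 k (k + b) + m (m + d) = (m + 2k) (m + 2k + d)`.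
The remaining term is multiplication by `c² t`, a symmetric operator between `0` and `c²` on `L²((0,
1), t ^ (b - 1) dt)`, so by a min-max argument each eigenvalue rises by at most `c²`.

The Hilbert space part is `exists_strictMono_weakEigenvalues`: for a diagonal operator `D` with
entries tending to infinity and a bounded `B` with `0 ≤ B ≤ β`, the resolvent of `D + B` is compact,
so the eigenvectors are complete, and dimension counts in both directions give the bounds.
Simplicity of the eigenvalues makes the enumeration strict.

The link between this weak problem and `C²` eigenfunctions is the moment equation: the eigenvalue
equation tested against every `t ^ n`. It is a recurrence, so the zeroth moment determines all the
others (`SatisfiesMomentEquation.moment_eq_zero`), which gives simplicity. A smooth eigenfunction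
satisfies it by Green's formula, with vanishing boundary terms (`satisfiesMomentEquation_of_ray`).

For the converse no regularity theory is used. Weighting the `n`-th moment of a weak solution `v`
suitably turns the moment recurrence into the Taylor recurrence of the same differential equation
(`exists_entire_solution`). Formally the new function is `u(t) = ∫ k(ts) v(s) s ^ (b - 1) ds` with a
Bessel-type kernel `k`, the finite Hankel transform that commutes with the differential operator; it
is entire, and `u(0) ≠ 0`. -/

open Filter Topology
open MeasureTheory Set


/-! ### Enumerating a set of reals from bounds on its counting function. -/

/-- A set of reals whose counting function is controlled by a sequence tending to infinity can be
enumerated increasingly, with the corresponding bounds on the enumeration. -/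
theorem exists_strictMono_enumeration {S : Set ℝ} {δ : ℕ → ℝ} {β : ℝ}
    (hδ : Tendsto δ atTop atTop)
    (hlow : ∀ (k : ℕ) (F : Finset ℝ), (∀ x ∈ F, x ∈ S ∧ x < δ k) → F.card ≤ k)
    (hup : ∀ (k : ℕ) (F : Finset ℝ), (∀ x ∈ S, x ≤ δ k + β → x ∈ F) → k + 1 ≤ F.card) :
    ∃ χ : ℕ → ℝ, StrictMono χ ∧ Set.range χ = S ∧ ∀ k, δ k ≤ χ k ∧ χ k ≤ δ k + β := by
  classical
  have hfin : ∀ x : ℝ, (S ∩ Set.Iio x).Finite := by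
    intro x
    obtain ⟨k, hk⟩ := (hδ.eventually_ge_atTop x).exists
    by_contra hinf
    obtain ⟨F, hF, hc⟩ := Set.Infinite.exists_subset_card_eq hinf (k + 1)
    have := hlow k F fun y hy => ⟨(hF hy).1, lt_of_lt_of_le (hF hy).2 hk⟩
    omega
  have hSinf : S.Infinite := by
    intro hS
    -- If `S` were finite, `hup` with `F = S` and `k` its own cardinality would give `k + 1 ≤ k`.
    have h1 := hup hS.toFinset.card hS.toFinset fun x hx _ => by simpa using hx
    omega
  -- Counting predecessors embeds `S` monotonically in `ℕ`; its image is infinite, hence order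
  -- isomorphic to `ℕ`.
  let cnt : S → ℕ := fun x => (S ∩ Set.Iio (x : ℝ)).ncard
  have hcnt : StrictMono cnt := by
    intro x y hxy
    apply Set.ncard_lt_ncard _ (hfin _)
    refine ⟨fun z hz => ⟨hz.1, lt_trans hz.2 (show (x : ℝ) < y from hxy)⟩, fun h => ?_⟩
    have := h ⟨x.2, hxy⟩
    exact lt_irrefl (x : ℝ) this.2
  have : Infinite S := hSinf.to_subtype
  have : Infinite (Set.range cnt) := (Set.infinite_range_of_injective hcnt.injective).to_subtype
  let e : ℕ ≃o S := (Nat.Subtype.orderIsoOfNat (Set.range cnt)).trans (hcnt.orderIso cnt).symm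
  refine ⟨fun n => (e n : ℝ), fun a b hab => e.strictMono hab, ?_, fun k => ⟨?_, ?_⟩⟩
  · ext x
    constructor
    · rintro ⟨n, rfl⟩
      exact (e n).2
    · intro hx
      exact ⟨e.symm ⟨x, hx⟩, by simp⟩
  · by_contra! h
    have h1 := hlow k ((Finset.range (k + 1)).image fun n => (e n : ℝ)) (by
      intro x hx
      obtain ⟨n, hn, rfl⟩ := Finset.mem_image.1 hx
      refine ⟨(e n).2, lt_of_le_of_lt ?_ h⟩
      exact e.monotone (by simpa [Nat.lt_succ_iff] using hn))
    rw [Finset.card_image_of_injective _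
      (fun a b hab => e.injective (Subtype.val_injective hab))] at h1
    simp at h1
  · by_contra! h
    have h1 := hup k ((Finset.range k).image fun n => (e n : ℝ)) (by
      intro x hx hxk
      refine Finset.mem_image.2 ⟨e.symm ⟨x, hx⟩, ?_, by simp⟩
      rw [Finset.mem_range, ← e.lt_iff_lt]
      simp only [OrderIso.apply_symm_apply]
      exact Subtype.coe_lt_coe.1 (lt_of_le_of_lt hxk h))
    have h2 := (Finset.card_image_le (s := Finset.range k) (f := fun n => (e n : ℝ)))
    simp at h2
    omega

/-! ### Bounded non-negative perturbations of a diagonal operator. -/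

section Hilbert

variable {E : Type*} [NormedAddCommGroup E] [InnerProductSpace ℝ E]

local notation "⟪" x ", " y "⟫" => inner ℝ x y

/-- `v` solves `(D + B) v = l v` weakly, where `D` is the diagonal operator with entries `δ` in
the Hilbert basis `p`. -/
def IsWeakEigenvector (p : HilbertBasis ℕ ℝ E) (δ : ℕ → ℝ) (B : E →L[ℝ] E) (l : ℝ) (v : E) :
    Prop :=
  ∀ n, δ n * ⟪p n, v⟫ + ⟪p n, B v⟫ = l * ⟪p n, v⟫

theorem HilbertBasis.hasSum_inner_sq {ι : Type*} (p : HilbertBasis ι ℝ E) (v : E) :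
    HasSum (fun n => ⟪p n, v⟫ ^ 2) (‖v‖ ^ 2) := by
  rw [← real_inner_self_eq_norm_sq]
  have h : (fun n => ⟪p n, v⟫ ^ 2) = fun n => ⟪v, p n⟫ * ⟪p n, v⟫ :=
    funext fun n => by rw [real_inner_comm (p n) v, sq]
  rw [h]
  exact p.hasSum_inner_mul_inner v v

theorem HilbertBasis.ext_inner {ι : Type*} (p : HilbertBasis ι ℝ E) {v w : E}
    (h : ∀ n, ⟪p n, v⟫ = ⟪p n, w⟫) : v = w := by
  apply p.repr.injective
  ext n
  simpa [p.repr_apply_apply] using h n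

theorem HilbertBasis.norm_le_of_diagonal (p : HilbertBasis ℕ ℝ E) {s : ℕ → ℝ} {C : ℝ}
    (hC : 0 ≤ C) (hs : ∀ n, |s n| ≤ C) {x v : E}
    (hx : ∀ n, ⟪p n, x⟫ = s n * ⟪p n, v⟫) : ‖x‖ ≤ C * ‖v‖ := by
  refine le_of_sq_le_sq ?_ (by positivity)
  rw [mul_pow]
  refine hasSum_le (fun n => ?_) (p.hasSum_inner_sq x) ((p.hasSum_inner_sq v).mul_left (C ^ 2))
  rw [hx, mul_pow]
  have : s n ^ 2 ≤ C ^ 2 := sq_le_sq' (abs_le.1 (hs n)).1 (abs_le.1 (hs n)).2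
  gcongr

theorem HilbertBasis.exists_diagonal (p : HilbertBasis ℕ ℝ E) {s : ℕ → ℝ} {C : ℝ}
    (hs : ∀ n, |s n| ≤ C) : ∃ S : E →L[ℝ] E, ∀ n v, ⟪p n, S v⟫ = s n * ⟪p n, v⟫ := by
  have hC : 0 ≤ C := (abs_nonneg _).trans (hs 0)
  have hmem : ∀ v : E, Memℓp (fun n => s n * ⟪p n, v⟫) 2 := by
    intro v
    refine memℓp_gen ?_
    refine Summable.of_nonneg_of_le (fun n => by positivity) (fun n => ?_)
      ((p.hasSum_inner_sq v).summable.mul_left (C ^ 2))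
    have : s n ^ 2 ≤ C ^ 2 := sq_le_sq' (abs_le.1 (hs n)).1 (abs_le.1 (hs n)).2
    simp only [ENNReal.toReal_ofNat, Real.rpow_ofNat, Real.norm_eq_abs, sq_abs, mul_pow]
    gcongr
  let f : E → E := fun v => p.repr.symm ⟨fun n => s n * ⟪p n, v⟫, hmem v⟩
  have hf : ∀ n v, ⟪p n, f v⟫ = s n * ⟪p n, v⟫ := by
    intro n v
    rw [← p.repr_apply_apply]
    simp [f]
  let S : E →ₗ[ℝ] E :=
    { toFun := f
      map_add' := fun v w => p.ext_inner fun n => by simp only [hf, inner_add_right]; ring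
      map_smul' := fun c v => p.ext_inner fun n => by
        simp only [hf, inner_smul_right, RingHom.id_apply]; ring }
  exact ⟨S.mkContinuous C fun v => p.norm_le_of_diagonal hC hs fun n => hf n v, hf⟩

theorem InnerProductSpace.isCompactOperator_rankOne (x y : E) :
    IsCompactOperator (InnerProductSpace.rankOne ℝ x y) := by
  have h : IsCompactOperator (ContinuousLinearMap.toSpanSingleton ℝ x) :=
    isCompactOperator_of_locallyCompactSpace_rng _
  have := h.comp_clm (innerSL ℝ y)
  exact this

/-- The finite-rank truncations converge in operator norm, since the tail of `s` bounds the error.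
-/
theorem HilbertBasis.isCompactOperator_of_diagonal [CompleteSpace E] (p : HilbertBasis ℕ ℝ E)
    {s : ℕ → ℝ} (hs : Tendsto s atTop (𝓝 0)) {S : E →L[ℝ] E}
    (hS : ∀ n v, ⟪p n, S v⟫ = s n * ⟪p n, v⟫) : IsCompactOperator S := by
  let F : ℕ → E →L[ℝ] E := fun N =>
    ∑ n ∈ Finset.range N, s n • InnerProductSpace.rankOne ℝ (p n) (p n)
  have hF : ∀ N, IsCompactOperator (F N) := by
    intro N
    have : F N ∈ compactOperator (RingHom.id ℝ) E E :=
      Submodule.sum_mem _ fun n _ => Submodule.smul_mem _ _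
        (InnerProductSpace.isCompactOperator_rankOne (p n) (p n))
    exact this
  refine isCompactOperator_of_tendsto (F := F) (l := atTop) ?_ (Eventually.of_forall hF)
  rw [Metric.tendsto_atTop]
  intro ε hε
  obtain ⟨N, hN⟩ := Metric.tendsto_atTop.1 hs (ε / 2) (by positivity)
  refine ⟨N, fun M hM => ?_⟩
  rw [dist_comm, dist_eq_norm]
  refine lt_of_le_of_lt (ContinuousLinearMap.opNorm_le_bound _ (by positivity : 0 ≤ ε / 2)
    fun v => ?_) (half_lt_self hε)
  refine p.norm_le_of_diagonal (s := fun n => if n < M then 0 else s n) (by positivity)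
    (fun n => ?_) (fun n => ?_)
  · split_ifs with h
    · simp; positivity
    · have := hN n (by omega)
      rw [Real.dist_eq, sub_zero] at this
      exact this.le
  · have hFn : ⟪p n, F M v⟫ = if n < M then s n * ⟪p n, v⟫ else 0 := by
      simp only [F, sum_apply, smul_apply,
        InnerProductSpace.rankOne_apply, inner_sum, inner_smul_right,
        orthonormal_iff_ite.1 p.orthonormal]
      simp
    rw [sub_apply, inner_sub_right, hS, hFn]
    split_ifs <;> simp

namespace IsWeakEigenvector

variable {p : HilbertBasis ℕ ℝ E} {δ : ℕ → ℝ} {B : E →L[ℝ] E}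

/-- Both `l ⟪v, w⟫ - ⟪B v, w⟫` and `l' ⟪v, w⟫ - ⟪v, B w⟫` expand termwise to `∑ δ n ⟪p n, v⟫ ⟪p n,
w⟫`. This is the symmetry of `D`, obtained without ever placing `D v` in `E`. -/
theorem inner_eq_zero (hB : ∀ v w, ⟪B v, w⟫ = ⟪v, B w⟫) {l l' : ℝ} (hl : l ≠ l') {v w : E}
    (hv : IsWeakEigenvector p δ B l v) (hw : IsWeakEigenvector p δ B l' w) : ⟪v, w⟫ = 0 := by
  have h1 := ((p.hasSum_inner_mul_inner v w).mul_left l).sub (p.hasSum_inner_mul_inner (B v) w)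
  have h2 := ((p.hasSum_inner_mul_inner v w).mul_left l').sub (p.hasSum_inner_mul_inner v (B w))
  have h3 : ⟪B v, w⟫ = ⟪v, B w⟫ := hB v w
  have h4 : l * ⟪v, w⟫ - ⟪B v, w⟫ = l' * ⟪v, w⟫ - ⟪v, B w⟫ := by
    refine h1.unique ?_
    convert h2 using 2 with n
    have e1 := hv n
    have e2 := hw n
    rw [real_inner_comm (p n) v, real_inner_comm (p n) (B v)]
    linear_combination ⟪p n, v⟫ * e2 - ⟪p n, w⟫ * e1
  have h5 : (l - l') * ⟪v, w⟫ = 0 := by linear_combination h4 + h3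
  exact (mul_eq_zero.1 h5).resolve_left (sub_ne_zero.2 hl)

end IsWeakEigenvector

/-- The weak eigenvectors of `D + B`, for `D` diagonal with entries tending to infinity and `B`
bounded, symmetric and non-negative, are complete. -/
theorem eq_zero_of_inner_weakEigenvector [CompleteSpace E] {p : HilbertBasis ℕ ℝ E} {δ : ℕ → ℝ}
    {B : E →L[ℝ] E} (hB : ∀ v w, ⟪B v, w⟫ = ⟪v, B w⟫) (hB0 : ∀ v, 0 ≤ ⟪B v, v⟫) (hδ0 : ∀ n, 0 ≤ δ n)
    (hδ : Tendsto δ atTop atTop) {x : E}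
    (hx : ∀ l v, IsWeakEigenvector p δ B l v → ⟪v, x⟫ = 0) : x = 0 := by
  -- With `S = (D + 1)^(-1/2)`, the resolvent `(D + B + 1)⁻¹` is `S K⁻¹ S` for `K = 1 + S B S`. This
  -- avoids unbounded operators.
  set s : ℕ → ℝ := fun n => (Real.sqrt (δ n + 1))⁻¹ with hs
  have hspos : ∀ n, 0 < s n := fun n => by
    have := hδ0 n
    simp only [hs]; positivity
  have hs2 : ∀ n, s n ^ 2 * (δ n + 1) = 1 := fun n => by
    have := hδ0 n
    simp only [hs, inv_pow]
    rw [Real.sq_sqrt (by positivity), inv_mul_cancel₀ (by positivity)]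
  have hs1 : ∀ n, |s n| ≤ 1 := fun n => by
    have h1 := hs2 n
    have := hδ0 n
    rw [abs_of_pos (hspos n)]
    nlinarith [hspos n, sq_nonneg (s n)]
  have hst : Tendsto s atTop (𝓝 0) :=
    tendsto_inv_atTop_zero.comp (Real.tendsto_sqrt_atTop.comp (tendsto_atTop_add_const_right _ _ hδ))
  obtain ⟨S, hS⟩ := p.exists_diagonal hs1
  have hSc := p.isCompactOperator_of_diagonal hst hS
  have hSs : ∀ v w, ⟪S v, w⟫ = ⟪v, S w⟫ := by
    intro v w
    refine (p.hasSum_inner_mul_inner (S v) w).unique ?_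
    convert p.hasSum_inner_mul_inner v (S w) using 2 with n
    rw [real_inner_comm (p n) (S v), hS, hS, real_inner_comm (p n) v]
    ring
  have hSinj : ∀ v, S v = 0 → v = 0 := by
    intro v hv
    refine p.ext_inner fun n => ?_
    have := hS n v
    rw [hv, inner_zero_right] at this
    rw [inner_zero_right]
    exact (mul_eq_zero.1 this.symm).resolve_left (hspos n).ne'
  let K : E →L[ℝ] E := ContinuousLinearMap.id ℝ E + S ∘L B ∘L S
  have hKapp : ∀ v, K v = v + S (B (S v)) := fun v => rfl
  have hKself : ∀ v, ‖v‖ * ‖v‖ ≤ ⟪K v, v⟫ := by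
    intro v
    rw [hKapp, inner_add_left, hSs, real_inner_self_eq_norm_mul_norm]
    linarith [hB0 (S v)]
  have hKs : ∀ v w, ⟪K v, w⟫ = ⟪v, K w⟫ := by
    intro v w
    rw [hKapp, hKapp, inner_add_left, inner_add_right, hSs, hB (S v) (S w), hSs]
  -- As `B ≥ 0`, `K ≥ 1`, so Lax–Milgram inverts `K`.
  have hco : IsCoercive ((innerSL ℝ).comp K : E →L[ℝ] E →L[ℝ] ℝ) :=
    ⟨1, one_pos, fun v => by simpa using hKself v⟩
  let e := hco.continuousLinearEquivOfBilin
  have he : ∀ v, e v = K v := by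
    intro v
    refine ext_inner_right ℝ fun w => ?_
    simp [e]
  have hKe : ∀ v, K (e.symm v) = v := fun v => by rw [← he, e.apply_symm_apply]
  have hes : ∀ v w, ⟪e.symm v, w⟫ = ⟪v, e.symm w⟫ := by
    intro v w
    conv_lhs => rw [← hKe w]
    rw [← hKs, hKe]
  let R : E →L[ℝ] E := S ∘L (e.symm : E →L[ℝ] E) ∘L S
  have hRapp : ∀ v, R v = S (e.symm (S v)) := fun v => rfl
  have hRc : IsCompactOperator R := hSc.comp_clm ((e.symm : E →L[ℝ] E) ∘L S)
  have hRs : R.IsSymmetric := by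
    intro v w
    change ⟪R v, w⟫ = ⟪v, R w⟫
    rw [hRapp, hRapp, hSs, hes, hSs]
  have hbot := R.orthogonalComplement_iSup_eigenspaces_eq_bot hRc hRs
  have hmem : x ∈ (⨆ μ, Module.End.eigenspace (R : Module.End ℝ E) μ)ᗮ := by
    rw [← Submodule.iInf_orthogonal, Submodule.mem_iInf]
    intro μ
    rw [Submodule.mem_orthogonal]
    intro z hz
    rw [Module.End.mem_eigenspace_iff] at hz
    replace hz : S (e.symm (S z)) = μ • z := hz
    rcases eq_or_ne z 0 with rfl | hz0
    · simp
    set w := e.symm (S z) with hw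
    have hKw : w + S (B (S w)) = S z := by rw [← hKapp, hw, hKe]
    have hμ : μ ≠ 0 := by
      rintro rfl
      rw [zero_smul] at hz
      have h1 := hSinj _ hz
      rw [h1] at hKw
      simp only [map_zero, add_zero] at hKw
      exact hz0 (hSinj _ hKw.symm)
    -- An eigenvalue `μ` of `(D + B + 1)⁻¹` corresponds to the eigenvalue `μ⁻¹ - 1` of `D + B`.
    refine hx (μ⁻¹ - 1) z fun n => ?_
    have h1 : ⟪p n, w⟫ + s n * (μ * ⟪p n, B z⟫) = s n * ⟪p n, z⟫ := by
      rw [← hS, ← hKw, inner_add_right, hS, hz, map_smul, inner_smul_right]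
    have h2 : s n * ⟪p n, w⟫ = μ * ⟪p n, z⟫ := by
      rw [← hS, hz, inner_smul_right]
    have h3 : μ * (⟪p n, z⟫ + s n ^ 2 * ⟪p n, B z⟫) = s n ^ 2 * ⟪p n, z⟫ := by
      linear_combination s n * h1 - h2
    have h4 : ⟪p n, z⟫ + s n ^ 2 * ⟪p n, B z⟫ = s n ^ 2 * (μ⁻¹ * ⟪p n, z⟫) := by
      field_simp
      linear_combination h3
    have h5 : (δ n + 1) * (⟪p n, z⟫ + s n ^ 2 * ⟪p n, B z⟫)
        = (δ n + 1) * (s n ^ 2 * (μ⁻¹ * ⟪p n, z⟫)) := by rw [h4]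
    linear_combination h5 + (μ⁻¹ * ⟪p n, z⟫ - ⟪p n, B z⟫) * hs2 n
  rw [hbot] at hmem
  simpa using hmem

/-- The dimension count behind both min-max bounds: it finds a nonzero coefficient vector for a
combination subject to fewer orthogonality conditions than it has terms. -/
theorem exists_ne_zero_forall_sum_eq_zero {ι κ : Type*} [Fintype ι] [Fintype κ]
    (h : Fintype.card κ < Fintype.card ι) (a : κ → ι → ℝ) :
    ∃ c : ι → ℝ, c ≠ 0 ∧ ∀ n, ∑ i, c i * a n i = 0 := by
  have hk := LinearMap.ker_ne_bot_of_finrank_lt (f := Matrix.mulVecLin (Matrix.of a)) (by simpa)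
  obtain ⟨c, hc, hc0⟩ := Submodule.exists_mem_ne_zero_of_ne_bot hk
  refine ⟨c, hc0, fun n => ?_⟩
  have := congrFun (LinearMap.mem_ker.1 hc) n
  simpa [Matrix.mulVec, dotProduct, mul_comm] using this

/-- The weak eigenvalues of `D + B`, if simple, form an increasing sequence that lies within the
bounds of `B` of the diagonal entries of `D`. -/
theorem exists_strictMono_weakEigenvalues [CompleteSpace E] {p : HilbertBasis ℕ ℝ E} {δ : ℕ → ℝ}
    {B : E →L[ℝ] E} {β : ℝ} (hB : ∀ v w, ⟪B v, w⟫ = ⟪v, B w⟫) (hB0 : ∀ v, 0 ≤ ⟪B v, v⟫)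
    (hBβ : ∀ v, ⟪B v, v⟫ ≤ β * ‖v‖ ^ 2) (hδ0 : 0 ≤ δ 0) (hδm : Monotone δ)
    (hδ : Tendsto δ atTop atTop)
    (hsimple : ∀ l v w, IsWeakEigenvector p δ B l v → IsWeakEigenvector p δ B l w → v ≠ 0 →
      ∃ c : ℝ, w = c • v) :
    ∃ χ : ℕ → ℝ, StrictMono χ ∧ Set.range χ = {l | ∃ v, v ≠ 0 ∧ IsWeakEigenvector p δ B l v} ∧
      ∀ k, δ k ≤ χ k ∧ χ k ≤ δ k + β := by
  set S : Set ℝ := {l | ∃ v, v ≠ 0 ∧ IsWeakEigenvector p δ B l v} with hSdef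
  have hunit : ∀ l : S, ∃ u : E, ‖u‖ = 1 ∧ IsWeakEigenvector p δ B l u := by
    rintro ⟨l, v, hv0, hv⟩
    refine ⟨‖v‖⁻¹ • v, by
      rw [norm_smul, norm_inv, norm_norm, inv_mul_cancel₀ (norm_ne_zero_iff.2 hv0)], fun n => ?_⟩
    simp only [map_smul, inner_smul_right]
    linear_combination ‖v‖⁻¹ * hv n
  choose u hu1 hu using hunit
  have huo : Orthonormal ℝ u :=
    ⟨hu1, fun i j hij => (hu i).inner_eq_zero hB (fun h => hij (Subtype.ext h)) (hu j)⟩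
  -- By simplicity, one unit vector per eigenvalue already spans every eigenspace.
  have hcomplete : (Submodule.span ℝ (Set.range u))ᗮ = ⊥ := by
    rw [Submodule.eq_bot_iff]
    intro x hx
    refine eq_zero_of_inner_weakEigenvector (p := p) hB hB0 (fun n => hδ0.trans (hδm n.zero_le)) hδ
      fun l v hv => ?_
    rcases eq_or_ne v 0 with rfl | hv0
    · simp
    · have hl : l ∈ S := ⟨v, hv0, hv⟩
      obtain ⟨c, rfl⟩ := hsimple l (u ⟨l, hl⟩) v (hu _) hv (huo.ne_zero _)
      rw [inner_smul_left, Submodule.inner_right_of_mem_orthogonal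
        (Submodule.subset_span (Set.mem_range_self _)) hx, mul_zero]
  let q : HilbertBasis S ℝ E := HilbertBasis.mkOfOrthogonalEqBot huo hcomplete
  have hq : ⇑q = u := HilbertBasis.coe_mkOfOrthogonalEqBot huo hcomplete
  refine exists_strictMono_enumeration hδ (fun k F hF => ?_) (fun k F hF => ?_)
  -- Lower bound. Given more than `k` eigenvalues below `δ k`, some nonzero combination `v` of their
  -- eigenvectors is orthogonal to `p 0, …, p (k - 1)`. Then `⟪v, D v⟫ ≥ δ k ‖v‖²`, while the
  -- spectral expansion gives `⟪v, (D + B) v⟫ < δ k ‖v‖²`, against `B ≥ 0`. Here `y` stands for `(D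
  -- + B) v`.
  · by_contra! hcard
    let u' : F → E := fun x => u ⟨x, (hF x x.2).1⟩
    have hu'o : Orthonormal ℝ u' := huo.comp (fun x : F => (⟨x, (hF x x.2).1⟩ : S))
      fun x y h => Subtype.ext (congrArg (fun z : S => (z : ℝ)) h)
    obtain ⟨c, hc0, hc⟩ := exists_ne_zero_forall_sum_eq_zero (ι := F) (κ := Fin k) (by simpa)
      fun n x => ⟪p n, u' x⟫
    set v : E := ∑ x, c x • u' x with hv
    set y : E := ∑ x, (x * c x : ℝ) • u' x with hy
    have hvn : ∀ n < k, ⟪p n, v⟫ = 0 := fun n hn => by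
      simpa [hv, inner_sum, inner_smul_right] using hc ⟨n, hn⟩
    have hyn : ∀ n, ⟪p n, y⟫ = δ n * ⟪p n, v⟫ + ⟪p n, B v⟫ := by
      intro n
      simp only [hv, hy, map_sum, map_smul, inner_sum, inner_smul_right, Finset.mul_sum]
      rw [← Finset.sum_add_distrib]
      refine Finset.sum_congr rfl fun x _ => ?_
      linear_combination -c x * hu ⟨x, (hF x x.2).1⟩ n
    have hvy : ⟪v, y⟫ = ∑ x : F, (x : ℝ) * c x ^ 2 := by
      rw [hv, hy, hu'o.inner_sum]
      exact Finset.sum_congr rfl fun x _ => by simp; ring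
    have hvv : ‖v‖ ^ 2 = ∑ x, c x ^ 2 := by
      rw [← real_inner_self_eq_norm_sq, hv, hu'o.inner_sum]
      exact Finset.sum_congr rfl fun x _ => by simp; ring
    have h1 : δ k * ‖v‖ ^ 2 ≤ ⟪v, y⟫ - ⟪v, B v⟫ := by
      refine hasSum_le (fun n => ?_) ((p.hasSum_inner_sq v).mul_left (δ k))
        ((p.hasSum_inner_mul_inner v y).sub (p.hasSum_inner_mul_inner v (B v)))
      rw [hyn, real_inner_comm (p n) v]
      rcases lt_or_ge n k with h | h
      · rw [hvn n h]; simp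
      · nlinarith [hδm h, sq_nonneg ⟪p n, v⟫]
    have h2 := hB0 v
    rw [real_inner_comm] at h2
    have h3 : ∑ x : F, (x : ℝ) * c x ^ 2 < ∑ x : F, δ k * c x ^ 2 := by
      obtain ⟨x, hx⟩ := Function.ne_iff.1 hc0
      refine Finset.sum_lt_sum (fun x _ => ?_) ⟨x, Finset.mem_univ x, ?_⟩
      · exact mul_le_mul_of_nonneg_right (hF x x.2).2.le (sq_nonneg _)
      · exact mul_lt_mul_of_pos_right (hF x x.2).2 (sq_pos_of_ne_zero hx)
    rw [← Finset.mul_sum, ← hvv, ← hvy] at h3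
    linarith
  -- Upper bound, dually. Some nonzero `v` in the span of `p 0, …, p k` is orthogonal to all
  -- eigenvectors with eigenvalue at most `δ k + β`, so its form exceeds `(δ k + β) ‖v‖²`; yet `D ≤
  -- δ k` on that span and `B ≤ β`. Here `z` is `D v`.
  · by_contra! hcard
    classical
    -- `F` may contain points that are not eigenvalues; the default `0` makes their conditions
    -- empty.
    obtain ⟨c, hc0, hc⟩ := exists_ne_zero_forall_sum_eq_zero (ι := Fin (k + 1)) (κ := F)
      (by simp; omega)
      fun x i => if h : (x : ℝ) ∈ S then ⟪p i, u ⟨x, h⟩⟫ else 0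
    have hpo : Orthonormal ℝ fun i : Fin (k + 1) => p i :=
      p.orthonormal.comp _ Fin.val_injective
    set v : E := ∑ i : Fin (k + 1), c i • p i with hv
    set z : E := ∑ i : Fin (k + 1), (c i * δ i) • p i with hz
    have hvu : ∀ s : S, (s : ℝ) ≤ δ k + β → ⟪u s, v⟫ = 0 := by
      intro s hs
      have := hc ⟨s, hF s s.2 hs⟩
      simp only [Subtype.coe_prop, dite_true, Subtype.coe_eta] at this
      simp only [hv, inner_sum, inner_smul_right]
      rw [← this]
      exact Finset.sum_congr rfl fun i _ => by rw [real_inner_comm]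
    have hyu : ∀ s : S, ⟪u s, z + B v⟫ = s * ⟪u s, v⟫ := by
      intro s
      rw [inner_add_right, ← hB]
      simp only [hv, hz, inner_sum, inner_smul_right, Finset.mul_sum]
      rw [← Finset.sum_add_distrib]
      refine Finset.sum_congr rfl fun i _ => ?_
      rw [real_inner_comm (p i) (u s), real_inner_comm (p i) (B (u s))]
      linear_combination c i * hu s i
    have hvz : ⟪v, z⟫ = ∑ i : Fin (k + 1), δ i * c i ^ 2 := by
      rw [hv, hz, hpo.inner_sum]
      exact Finset.sum_congr rfl fun x _ => by simp; ring
    have hvv : ‖v‖ ^ 2 = ∑ x, c x ^ 2 := by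
      rw [← real_inner_self_eq_norm_sq, hv, hpo.inner_sum]
      exact Finset.sum_congr rfl fun x _ => by simp; ring
    have hv0 : v ≠ 0 := by
      intro h
      rw [h, norm_zero] at hvv
      apply hc0
      funext i
      have := (Finset.sum_eq_zero_iff_of_nonneg fun i _ => sq_nonneg (c i)).1
        (hvv.symm.trans (by simp)) i (Finset.mem_univ i)
      simpa using this
    obtain ⟨s, hs⟩ : ∃ s, ⟪u s, v⟫ ≠ 0 := by
      by_contra! h
      exact hv0 (q.ext_inner fun s => by rw [hq, h, inner_zero_right])
    have hgt : δ k + β < s := by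
      by_contra! h
      exact hs (hvu s h)
    have h1 : (δ k + β) * ‖v‖ ^ 2 < ⟪v, z + B v⟫ := by
      refine hasSum_lt (i := s) (fun n => ?_) ?_ ((q.hasSum_inner_sq v).mul_left (δ k + β))
        (q.hasSum_inner_mul_inner v (z + B v))
      · rw [hq, hyu, real_inner_comm (u n) v]
        rcases le_or_gt (n : ℝ) (δ k + β) with h | h
        · rw [hvu n h]; simp
        · nlinarith [sq_nonneg ⟪u n, v⟫]
      · simp only [hq]
        rw [hyu, real_inner_comm (u s) v]
        have := sq_pos_of_ne_zero hs
        nlinarith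
    have h2 : ∑ i : Fin (k + 1), δ i * c i ^ 2 ≤ ∑ i : Fin (k + 1), δ k * c i ^ 2 :=
      Finset.sum_le_sum fun i _ => mul_le_mul_of_nonneg_right (hδm (by omega)) (sq_nonneg _)
    rw [← Finset.mul_sum, ← hvv, ← hvz] at h2
    have h3 := hBβ v
    rw [real_inner_comm] at h3
    rw [inner_add_right] at h1
    linarith

end Hilbert

/-! ### The weighted `L²` space on the unit interval and its moments. -/

/-- The measure `t ^ (b - 1) dt` on the unit interval. -/
noncomputable def jacobiMeasure (b : ℝ) : Measure ℝ :=
  (volume.restrict (Ioo (0 : ℝ) 1)).withDensity fun t => ENNReal.ofReal (t ^ (b - 1))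

section JacobiMeasure

variable {b : ℝ}

theorem ae_jacobiMeasure_mem_Ioo : ∀ᵐ t ∂jacobiMeasure b, t ∈ Ioo (0 : ℝ) 1 :=
  (withDensity_absolutelyContinuous _ _).ae_le (ae_restrict_mem measurableSet_Ioo)

theorem measurable_ofReal_rpow_sub_one :
    Measurable fun t : ℝ => ENNReal.ofReal (t ^ (b - 1)) := by fun_prop

theorem integrable_jacobiMeasure_iff {f : ℝ → ℝ} :
    Integrable f (jacobiMeasure b) ↔ IntegrableOn (fun t => t ^ (b - 1) * f t) (Ioo 0 1) := by
  rw [jacobiMeasure, integrable_withDensity_iff_integrable_smul' measurable_ofReal_rpow_sub_one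
    (ae_of_all _ fun _ => ENNReal.ofReal_lt_top), IntegrableOn]
  refine integrable_congr ?_
  filter_upwards [ae_restrict_mem measurableSet_Ioo] with t ht
  rw [ENNReal.toReal_ofReal (Real.rpow_nonneg ht.1.le _), smul_eq_mul]

theorem integral_jacobiMeasure (f : ℝ → ℝ) :
    ∫ t, f t ∂jacobiMeasure b = ∫ t in Ioo 0 1, t ^ (b - 1) * f t := by
  rw [jacobiMeasure, integral_withDensity_eq_integral_toReal_smul measurable_ofReal_rpow_sub_one
    (ae_of_all _ fun _ => ENNReal.ofReal_lt_top)]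
  refine integral_congr_ae ?_
  filter_upwards [ae_restrict_mem measurableSet_Ioo] with t ht
  rw [ENNReal.toReal_ofReal (Real.rpow_nonneg ht.1.le _), smul_eq_mul]

theorem isFiniteMeasure_jacobiMeasure (hb : 0 < b) : IsFiniteMeasure (jacobiMeasure b) := by
  have h : Integrable (fun _ => (1 : ℝ)) (jacobiMeasure b) := by
    rw [integrable_jacobiMeasure_iff]
    simp only [mul_one]
    exact (intervalIntegral.integrableOn_Ioo_rpow_iff one_pos).2 (by linarith)
  rcases (integrable_const_iff).1 h with h | h
  · norm_num at h
  · exact h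

theorem integral_pow_jacobiMeasure (hb : 0 < b) (n : ℕ) :
    ∫ t, t ^ n ∂jacobiMeasure b = (n + b)⁻¹ := by
  have h : ∀ t ∈ Ioo (0 : ℝ) 1, t ^ (b - 1) * t ^ n = t ^ (n + b - 1) := by
    intro t ht
    rw [← Real.rpow_natCast, ← Real.rpow_add ht.1]
    congr 1
    ring
  rw [integral_jacobiMeasure, setIntegral_congr_fun measurableSet_Ioo h,
    ← integral_Ioc_eq_integral_Ioo, ← intervalIntegral.integral_of_le zero_le_one,
    integral_rpow (Or.inl (by have := n.cast_nonneg (α := ℝ); linarith))]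
  have : (n : ℝ) + b ≠ 0 := by positivity
  simp [this]

theorem ae_volume_of_ae_jacobiMeasure {P : ℝ → Prop} (h : ∀ᵐ t ∂jacobiMeasure b, P t) :
    ∀ᵐ t, t ∈ Ioo (0 : ℝ) 1 → P t := by
  rw [jacobiMeasure, ae_withDensity_iff measurable_ofReal_rpow_sub_one,
    ae_restrict_iff' measurableSet_Ioo] at h
  filter_upwards [h] with t ht h01
  exact ht h01 (by simpa using Real.rpow_pos_of_pos h01.1 _)

theorem memLp_eval_jacobiMeasure (hb : 0 < b) (p : Polynomial ℝ) :
    MemLp (fun t => p.eval t) 2 (jacobiMeasure b) := by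
  have := isFiniteMeasure_jacobiMeasure hb
  obtain ⟨C, hC⟩ := isCompact_Icc.exists_bound_of_continuousOn
    (p.continuous.continuousOn (s := Icc (0 : ℝ) 1))
  refine MemLp.of_bound p.continuous.aestronglyMeasurable C ?_
  filter_upwards [ae_jacobiMeasure_mem_Ioo] with t ht
  exact hC t (Ioo_subset_Icc_self ht)

theorem integrable_eval_mul_jacobiMeasure (hb : 0 < b) (p : Polynomial ℝ) {v : ℝ → ℝ}
    (hv : MemLp v 2 (jacobiMeasure b)) :
    Integrable (fun t => p.eval t * v t) (jacobiMeasure b) :=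
  (memLp_eval_jacobiMeasure hb p).integrable_mul hv

theorem integrable_pow_mul_jacobiMeasure (hb : 0 < b) (n : ℕ) {v : ℝ → ℝ}
    (hv : MemLp v 2 (jacobiMeasure b)) :
    Integrable (fun t => t ^ n * v t) (jacobiMeasure b) := by
  simpa using integrable_eval_mul_jacobiMeasure hb (Polynomial.X ^ n) hv

/-- A square integrable function is determined by its moments. -/
theorem ae_eq_zero_of_moments_eq_zero (hb : 0 < b) {v : ℝ → ℝ} (hv : MemLp v 2 (jacobiMeasure b))
    (h : ∀ n : ℕ, ∫ t, t ^ n * v t ∂jacobiMeasure b = 0) : v =ᵐ[jacobiMeasure b] 0 := by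
  have := isFiniteMeasure_jacobiMeasure hb
  have hint : Integrable v (jacobiMeasure b) := hv.integrable (by norm_num)
  have hpoly : ∀ p : Polynomial ℝ, ∫ t, p.eval t * v t ∂jacobiMeasure b = 0 := by
    intro p
    simp only [Polynomial.eval_eq_sum_range, Finset.sum_mul, mul_assoc]
    rw [integral_finsetSum _ fun n _ => (integrable_pow_mul_jacobiMeasure hb n hv).const_mul _]
    simp [integral_const_mul, h]
  -- By Weierstrass, orthogonality to polynomials passes to smooth test functions, uniformly on `[0,
  -- 1]`, which carries the measure.
  refine ae_eq_zero_of_integral_contDiff_smul_eq_zero hint.locallyIntegrable fun g hg _ => ?_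
  have key : ∀ ε > 0, |∫ t, g t • v t ∂jacobiMeasure b| ≤ ε * ∫ t, |v t| ∂jacobiMeasure b := by
    intro ε hε
    obtain ⟨p, hp⟩ := exists_polynomial_near_of_continuousOn 0 1 g hg.continuous.continuousOn ε hε
    obtain ⟨C, hC⟩ := isCompact_Icc.exists_bound_of_continuousOn
      (hg.continuous.continuousOn (s := Icc (0 : ℝ) 1))
    have hgi : Integrable (fun t => g t * v t) (jacobiMeasure b) := by
      refine hint.bdd_mul hg.continuous.aestronglyMeasurable (c := C) ?_
      filter_upwards [ae_jacobiMeasure_mem_Ioo] with t ht using hC t (Ioo_subset_Icc_self ht)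
    have : ∫ t, g t • v t ∂jacobiMeasure b
        = -∫ t, (p.eval t * v t - g t * v t) ∂jacobiMeasure b := by
      rw [integral_sub (integrable_eval_mul_jacobiMeasure hb p hv) hgi, hpoly]
      simp
    rw [this, abs_neg, ← integral_const_mul]
    refine (abs_integral_le_integral_abs).trans (integral_mono_ae
      ((integrable_eval_mul_jacobiMeasure hb p hv).sub hgi).abs (hint.abs.const_mul ε) ?_)
    filter_upwards [ae_jacobiMeasure_mem_Ioo] with t ht
    rw [← sub_mul, abs_mul]
    exact mul_le_mul_of_nonneg_right (hp t (Ioo_subset_Icc_self ht)).le (abs_nonneg _)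
  have h0 : Tendsto (fun ε : ℝ => ε * ∫ t, |v t| ∂jacobiMeasure b) (𝓝[>] 0) (𝓝 0) := by
    have : Tendsto (fun ε : ℝ => ε * ∫ t, |v t| ∂jacobiMeasure b) (𝓝 0)
        (𝓝 (0 * ∫ t, |v t| ∂jacobiMeasure b)) := tendsto_id.mul_const _
    rw [zero_mul] at this
    exact this.mono_left nhdsWithin_le_nhds
  have := ge_of_tendsto h0 (eventually_mem_nhdsWithin.mono fun ε hε => key ε hε)
  exact abs_eq_zero.1 (le_antisymm this (abs_nonneg _))

/-- Multiplication by the coordinate, as a bounded operator. -/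
theorem exists_mulCoordinate (b : ℝ) :
    ∃ T : Lp ℝ 2 (jacobiMeasure b) →L[ℝ] Lp ℝ 2 (jacobiMeasure b),
      ∀ v, T v =ᵐ[jacobiMeasure b] fun t => t * v t := by
  have hmem : ∀ v : Lp ℝ 2 (jacobiMeasure b),
      MemLp (fun t => t * v t) 2 (jacobiMeasure b) := by
    intro v
    refine (Lp.memLp v).of_le ((continuous_id.aestronglyMeasurable).mul (Lp.aestronglyMeasurable v))
      ?_
    filter_upwards [ae_jacobiMeasure_mem_Ioo] with t ht
    rw [norm_mul, Real.norm_of_nonneg ht.1.le]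
    exact mul_le_of_le_one_left (norm_nonneg _) ht.2.le
  let T : Lp ℝ 2 (jacobiMeasure b) →ₗ[ℝ] Lp ℝ 2 (jacobiMeasure b) :=
    { toFun := fun v => (hmem v).toLp _
      map_add' := fun v w => by
        rw [← MemLp.toLp_add]
        refine MemLp.toLp_congr _ _ ?_
        filter_upwards [Lp.coeFn_add v w] with t ht
        simp only [ht, Pi.add_apply]; ring
      map_smul' := fun c v => by
        rw [RingHom.id_apply, ← MemLp.toLp_const_smul]
        refine MemLp.toLp_congr _ _ ?_
        filter_upwards [Lp.coeFn_smul c v] with t ht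
        simp only [ht, Pi.smul_apply, smul_eq_mul]; ring }
  refine ⟨T.mkContinuous 1 fun v => ?_, fun v => (hmem v).coeFn_toLp⟩
  rw [one_mul]
  refine Lp.norm_le_norm_of_ae_le ?_
  filter_upwards [ae_jacobiMeasure_mem_Ioo, (hmem v).coeFn_toLp] with t ht h
  change ‖((hmem v).toLp _ : Lp ℝ 2 (jacobiMeasure b)) t‖ ≤ _
  rw [h, norm_mul, Real.norm_of_nonneg ht.1.le]
  exact mul_le_of_le_one_left (norm_nonneg _) ht.2.le

end JacobiMeasure

/-! ### Jacobi polynomials as a Hilbert basis. -/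

/-- The eigenvalues `4 n (n + b)` of the Jacobi operator
`-4 (t (1 - t) g'' + (b - (b + 1) t) g')`. -/
def jacobiEigenvalue (b : ℝ) (n : ℕ) : ℝ := 4 * n * (n + b)

/-- The Jacobi operator maps `t ^ n` to
`jacobiEigenvalue b n * t ^ n - jacobiLower b n * t ^ (n - 1)`. -/
def jacobiLower (b : ℝ) (n : ℕ) : ℝ := 4 * n * (n + b - 1)

/-- The coefficients of the `n`-th Jacobi polynomial. -/
noncomputable def jacobiCoeff (b : ℝ) (n j : ℕ) : ℝ :=
  ∏ i ∈ Finset.range j,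
    (jacobiEigenvalue b i - jacobiEigenvalue b n) / jacobiLower b (i + 1)

section Jacobi

variable {b : ℝ}

theorem jacobiEigenvalue_strictMono (hb : 0 < b) : StrictMono (jacobiEigenvalue b) := by
  intro m n hmn
  have h : (m : ℝ) < n := by exact_mod_cast hmn
  have := m.cast_nonneg (α := ℝ)
  simp only [jacobiEigenvalue]
  nlinarith

theorem tendsto_jacobiEigenvalue (hb : 0 < b) : Tendsto (jacobiEigenvalue b) atTop atTop := by
  refine tendsto_atTop_mono (fun n => ?_) tendsto_natCast_atTop_atTop
  rcases n.eq_zero_or_pos with rfl | h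
  · simp [jacobiEigenvalue]
  · have h : (1 : ℝ) ≤ n := by exact_mod_cast h
    simp only [jacobiEigenvalue]
    nlinarith

theorem jacobiLower_succ_ne_zero (hb : 0 < b) (n : ℕ) : jacobiLower b (n + 1) ≠ 0 := by
  have : jacobiLower b (n + 1) = 4 * (n + 1) * (n + b) := by
    simp only [jacobiLower]; push_cast; ring
  rw [this]
  positivity

/-- This is the comparison of coefficients of `t ^ j` in the Jacobi eigenvalue equation. At `j = n`
the right side vanishes, which terminates the polynomial. -/
theorem jacobiCoeff_succ (hb : 0 < b) (n j : ℕ) :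
    jacobiLower b (j + 1) * jacobiCoeff b n (j + 1)
      = (jacobiEigenvalue b j - jacobiEigenvalue b n) * jacobiCoeff b n j := by
  rw [jacobiCoeff, Finset.prod_range_succ, ← jacobiCoeff]
  have := jacobiLower_succ_ne_zero hb j
  field_simp

theorem jacobiCoeff_self_ne_zero (hb : 0 < b) (n : ℕ) : jacobiCoeff b n n ≠ 0 := by
  refine Finset.prod_ne_zero_iff.2 fun i hi => div_ne_zero (sub_ne_zero.2 ?_)
    (jacobiLower_succ_ne_zero hb i)
  exact (jacobiEigenvalue_strictMono hb (Finset.mem_range.1 hi)).ne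

/-- The eigenvalue equation of the Jacobi polynomials, against an arbitrary linear functional with
moments `m`. -/
theorem jacobiEigenvalue_mul_sum (hb : 0 < b) (n : ℕ) (m : ℕ → ℝ) :
    jacobiEigenvalue b n * ∑ j ∈ Finset.range (n + 1), jacobiCoeff b n j * m j
      = ∑ j ∈ Finset.range (n + 1), jacobiCoeff b n j *
          (jacobiEigenvalue b j * m j - jacobiLower b j * m (j - 1)) := by
  have h1 : ∑ j ∈ Finset.range (n + 1), jacobiCoeff b n j * (jacobiLower b j * m (j - 1))
      = ∑ j ∈ Finset.range (n + 1),
          (jacobiEigenvalue b j - jacobiEigenvalue b n) * (jacobiCoeff b n j * m j) := by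
    -- Shift the index: the bottom term drops because `jacobiLower b 0 = 0`, the top one because its
    -- eigenvalue difference is zero.
    rw [Finset.sum_range_succ', Finset.sum_range_succ]
    have h0 : jacobiLower b 0 = 0 := by simp [jacobiLower]
    rw [h0, sub_self]
    simp only [zero_mul, mul_zero, add_zero]
    refine Finset.sum_congr rfl fun j _ => ?_
    rw [Nat.add_sub_cancel]
    linear_combination m j * jacobiCoeff_succ hb n j
  simp only [mul_sub, Finset.sum_sub_distrib, h1]
  rw [Finset.mul_sum, ← Finset.sum_sub_distrib]
  exact Finset.sum_congr rfl fun j _ => by ring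

/-- The system is triangular with nonzero diagonal. Hence testing against Jacobi polynomials and
against monomials are interchangeable. -/
theorem forall_jacobiCoeff_sum_eq_zero_iff (hb : 0 < b) (r : ℕ → ℝ) :
    (∀ n, ∑ j ∈ Finset.range (n + 1), jacobiCoeff b n j * r j = 0) ↔ ∀ j, r j = 0 := by
  refine ⟨fun h j => ?_, fun h n => by simp [h]⟩
  induction j using Nat.strong_induction_on with
  | _ j ih =>
    have := h j
    rw [Finset.sum_range_succ, Finset.sum_eq_zero fun i hi => by
      rw [ih i (Finset.mem_range.1 hi), mul_zero], zero_add] at this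
    exact (mul_eq_zero.1 this).resolve_left (jacobiCoeff_self_ne_zero hb j)

/-- The monomial `t ^ n` as an element of the weighted `L²` space. -/
noncomputable def monomialLp (hb : 0 < b) (n : ℕ) : Lp ℝ 2 (jacobiMeasure b) :=
  (memLp_eval_jacobiMeasure hb (Polynomial.X ^ n)).toLp _

theorem coeFn_monomialLp (hb : 0 < b) (n : ℕ) :
    monomialLp hb n =ᵐ[jacobiMeasure b] fun t => t ^ n := by
  refine (MemLp.coeFn_toLp _).trans (ae_of_all _ fun t => ?_)
  simp

theorem inner_monomialLp (hb : 0 < b) (n : ℕ) (v : Lp ℝ 2 (jacobiMeasure b)) :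
    inner ℝ (monomialLp hb n) v = ∫ t, t ^ n * v t ∂jacobiMeasure b := by
  rw [L2.inner_def]
  refine integral_congr_ae ?_
  filter_upwards [coeFn_monomialLp hb n] with t ht
  simp [ht, mul_comm]

theorem inner_monomialLp_monomialLp (hb : 0 < b) (n l : ℕ) :
    inner ℝ (monomialLp hb n) (monomialLp hb l) = ((n + l : ℕ) + b : ℝ)⁻¹ := by
  rw [inner_monomialLp, ← integral_pow_jacobiMeasure hb]
  refine integral_congr_ae ?_
  filter_upwards [coeFn_monomialLp hb l] with t ht
  rw [ht, pow_add]

theorem eq_zero_of_inner_monomialLp_eq_zero (hb : 0 < b) {v : Lp ℝ 2 (jacobiMeasure b)}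
    (h : ∀ n, inner ℝ (monomialLp hb n) v = 0) : v = 0 := by
  rw [Lp.eq_zero_iff_ae_eq_zero]
  exact ae_eq_zero_of_moments_eq_zero hb (Lp.memLp v) fun n => by
    rw [← inner_monomialLp hb, h]

/-- The `n`-th Jacobi polynomial as an element of the weighted `L²` space. -/
noncomputable def jacobiLp (hb : 0 < b) (n : ℕ) : Lp ℝ 2 (jacobiMeasure b) :=
  ∑ j ∈ Finset.range (n + 1), jacobiCoeff b n j • monomialLp hb j

theorem inner_jacobiLp (hb : 0 < b) (n : ℕ) (v : Lp ℝ 2 (jacobiMeasure b)) :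
    inner ℝ (jacobiLp hb n) v
      = ∑ j ∈ Finset.range (n + 1), jacobiCoeff b n j * inner ℝ (monomialLp hb j) v := by
  simp [jacobiLp, sum_inner, inner_smul_left]

theorem jacobiEigenvalue_mul_inner_jacobiLp (hb : 0 < b) (n : ℕ)
    (v : Lp ℝ 2 (jacobiMeasure b)) :
    jacobiEigenvalue b n * inner ℝ (jacobiLp hb n) v
      = ∑ j ∈ Finset.range (n + 1), jacobiCoeff b n j *
          (jacobiEigenvalue b j * inner ℝ (monomialLp hb j) v
            - jacobiLower b j * inner ℝ (monomialLp hb (j - 1)) v) := by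
  rw [inner_jacobiLp, jacobiEigenvalue_mul_sum hb n fun j => inner ℝ (monomialLp hb j) v]

/-- Symmetry of the Jacobi operator on monomials: both sides equal the Dirichlet form `4 ∫ t ^ b (1
- t) (t ^ j)' (t ^ l)' dt`, here evaluated in closed form. -/
theorem jacobi_inner_monomialLp_comm (hb : 0 < b) (j l : ℕ) :
    jacobiEigenvalue b j * inner ℝ (monomialLp hb j) (monomialLp hb l)
        - jacobiLower b j * inner ℝ (monomialLp hb (j - 1)) (monomialLp hb l)
      = jacobiEigenvalue b l * inner ℝ (monomialLp hb j) (monomialLp hb l)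
        - jacobiLower b l * inner ℝ (monomialLp hb j) (monomialLp hb (l - 1)) := by
  have key : ∀ j l : ℕ, jacobiEigenvalue b j * inner ℝ (monomialLp hb j) (monomialLp hb l)
        - jacobiLower b j * inner ℝ (monomialLp hb (j - 1)) (monomialLp hb l)
      = 4 * j * l / ((j + l + b) * (j + l + b - 1)) := by
    intro j l
    simp only [inner_monomialLp_monomialLp]
    rcases j with _ | j
    · simp [jacobiEigenvalue, jacobiLower]
    · rw [Nat.add_sub_cancel]
      simp only [jacobiEigenvalue, jacobiLower]
      push_cast
      have h1 : (j : ℝ) + l + b ≠ 0 := by positivity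
      have h2 : (j : ℝ) + 1 + l + b ≠ 0 := by positivity
      have h3 : (j : ℝ) + 1 + l + b - 1 ≠ 0 := by
        convert h1 using 1; ring
      field_simp
      ring
  rw [key, real_inner_comm (monomialLp hb l) (monomialLp hb j),
    real_inner_comm (monomialLp hb (l - 1)) (monomialLp hb j), key]
  congr 1 <;> ring

theorem inner_jacobiLp_jacobiLp (hb : 0 < b) {n k : ℕ} (hnk : n ≠ k) :
    inner ℝ (jacobiLp hb n) (jacobiLp hb k) = 0 := by
  have h : jacobiEigenvalue b n * inner ℝ (jacobiLp hb n) (jacobiLp hb k)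
      = jacobiEigenvalue b k * inner ℝ (jacobiLp hb n) (jacobiLp hb k) := by
    rw [jacobiEigenvalue_mul_inner_jacobiLp, inner_jacobiLp hb n, Finset.mul_sum]
    refine Finset.sum_congr rfl fun j _ => ?_
    rw [real_inner_comm (jacobiLp hb k), real_inner_comm (jacobiLp hb k), mul_left_comm,
      jacobiEigenvalue_mul_inner_jacobiLp, inner_jacobiLp, inner_jacobiLp, Finset.mul_sum,
      Finset.mul_sum, ← Finset.sum_sub_distrib]
    congr 1
    refine Finset.sum_congr rfl fun l _ => ?_
    have := jacobi_inner_monomialLp_comm hb l j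
    linear_combination -jacobiCoeff b k l * this
  have h1 : (jacobiEigenvalue b n - jacobiEigenvalue b k)
      * inner ℝ (jacobiLp hb n) (jacobiLp hb k) = 0 := by linear_combination h
  exact (mul_eq_zero.1 h1).resolve_left
    (sub_ne_zero.2 ((jacobiEigenvalue_strictMono hb).injective.ne hnk))

/-- A polynomial vanishing almost everywhere on `(0, 1)` has too many roots, and the leading
coefficient here is nonzero. -/
theorem jacobiLp_ne_zero (hb : 0 < b) (n : ℕ) : jacobiLp hb n ≠ 0 := by
  intro h0
  let P : Polynomial ℝ :=
    ∑ j ∈ Finset.range (n + 1), Polynomial.C (jacobiCoeff b n j) * Polynomial.X ^ j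
  have hP : P ≠ 0 := by
    intro h
    have : P.coeff n = jacobiCoeff b n n := by
      simp [P, Polynomial.coeff_X_pow]
    rw [h, Polynomial.coeff_zero] at this
    exact jacobiCoeff_self_ne_zero hb n this.symm
  have hae : (fun t => P.eval t) =ᵐ[jacobiMeasure b] 0 := by
    refine ae_eq_zero_of_moments_eq_zero hb (memLp_eval_jacobiMeasure hb P) fun l => ?_
    have h1 := inner_jacobiLp hb n (monomialLp hb l)
    rw [h0, inner_zero_left] at h1
    simp only [P, Polynomial.eval_finsetSum, Polynomial.eval_mul, Polynomial.eval_C,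
      Polynomial.eval_pow, Polynomial.eval_X, Finset.mul_sum]
    rw [integral_finsetSum]
    · rw [h1]
      refine Finset.sum_congr rfl fun j _ => ?_
      rw [inner_monomialLp_monomialLp, ← integral_pow_jacobiMeasure hb, ← integral_const_mul]
      exact integral_congr_ae (ae_of_all _ fun t => by simp only [pow_add]; ring)
    · intro j _
      have := (integrable_pow_mul_jacobiMeasure hb l
        (memLp_eval_jacobiMeasure hb (Polynomial.C (jacobiCoeff b n j) * Polynomial.X ^ j)))
      simpa using this
  have hvol := ae_volume_of_ae_jacobiMeasure hae
  have hroots : ∀ᵐ t : ℝ, t ∉ (P.roots.toFinset : Set ℝ) :=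
    measure_eq_zero_iff_ae_notMem.1 (Finset.measure_zero _ _)
  have hnone : ∀ᵐ t : ℝ, t ∉ Ioo (0 : ℝ) 1 := by
    filter_upwards [hvol, hroots] with t h1 h2 h3
    exact h2 (by simpa [hP] using h1 h3)
  have := measure_eq_zero_iff_ae_notMem.2 hnone
  simp at this

/-- The Hilbert basis of normalised Jacobi polynomials. -/
theorem exists_jacobiBasis (hb : 0 < b) :
    ∃ p : HilbertBasis ℕ ℝ (Lp ℝ 2 (jacobiMeasure b)),
      ∀ n, p n = ‖jacobiLp hb n‖⁻¹ • jacobiLp hb n := by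
  have ho : Orthonormal ℝ fun n => ‖jacobiLp hb n‖⁻¹ • jacobiLp hb n := by
    refine ⟨fun n => ?_, fun n k hnk => ?_⟩
    · rw [norm_smul, norm_inv, norm_norm, inv_mul_cancel₀ (norm_ne_zero_iff.2 (jacobiLp_ne_zero hb n))]
    · simp [inner_smul_left, inner_smul_right, inner_jacobiLp_jacobiLp hb hnk]
  have hbot : (Submodule.span ℝ (range fun n => ‖jacobiLp hb n‖⁻¹ • jacobiLp hb n))ᗮ = ⊥ := by
    rw [Submodule.eq_bot_iff]
    intro v hv
    refine eq_zero_of_inner_monomialLp_eq_zero hb ?_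
    rw [← forall_jacobiCoeff_sum_eq_zero_iff hb]
    intro n
    rw [← inner_jacobiLp]
    have := Submodule.inner_right_of_mem_orthogonal (Submodule.subset_span (mem_range_self n)) hv
    rw [inner_smul_left] at this
    exact (mul_eq_zero.1 this).resolve_left
      (by simpa using jacobiLp_ne_zero hb n)
  exact ⟨HilbertBasis.mkOfOrthogonalEqBot ho hbot, fun n => by
    rw [HilbertBasis.coe_mkOfOrthogonalEqBot]⟩

end Jacobi

/-! ### The moment equation and its spectrum. -/

/-- The moment form of the eigenvalue equation
`-4 (t (1 - t) v'' + (b - (b + 1) t) v') + κ t v = l v` on `(0, 1)`, for square integrable `v`. -/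
def SatisfiesMomentEquation (b κ l : ℝ) (v : ℝ → ℝ) : Prop :=
  ∀ n : ℕ, (jacobiEigenvalue b n - l) * ∫ t, t ^ n * v t ∂jacobiMeasure b
    = jacobiLower b n * (∫ t, t ^ (n - 1) * v t ∂jacobiMeasure b)
      - κ * ∫ t, t ^ (n + 1) * v t ∂jacobiMeasure b

/-- As `κ ≠ 0`, the equation at `n` expresses moment `n + 1` through the two before it (one if `n =
0`). This yields simplicity of the eigenvalues and, later, a nonzero value at the origin. -/
theorem SatisfiesMomentEquation.moment_eq_zero {b κ l : ℝ} (hκ : κ ≠ 0) {v : ℝ → ℝ}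
    (h : SatisfiesMomentEquation b κ l v) (h0 : ∫ t, v t ∂jacobiMeasure b = 0) (n : ℕ) :
    ∫ t, t ^ n * v t ∂jacobiMeasure b = 0 := by
  induction n using Nat.strong_induction_on with
  | _ n ih =>
    rcases n with _ | n
    · simpa using h0
    · have h1 := h n
      rw [ih n (by omega), ih (n - 1) (by omega)] at h1
      have h2 : κ * ∫ t, t ^ (n + 1) * v t ∂jacobiMeasure b = 0 := by linear_combination h1
      exact (mul_eq_zero.1 h2).resolve_left hκ

/-- The abstract theorem applies with `D` the Jacobi operator and `B = κ T`, where `T` is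
multiplication by `t` and `0 ≤ T ≤ 1`; `hweak` identifies weak eigenvectors with solutions of the
moment equation. -/
theorem exists_strictMono_momentEigenvalues {b κ : ℝ} (hb : 0 < b) (hκ : 0 < κ) :
    ∃ χ : ℕ → ℝ, StrictMono χ ∧
      Set.range χ = {l | ∃ v, MemLp v 2 (jacobiMeasure b) ∧ ¬ v =ᵐ[jacobiMeasure b] 0 ∧
        SatisfiesMomentEquation b κ l v} ∧
      ∀ k, jacobiEigenvalue b k ≤ χ k ∧ χ k ≤ jacobiEigenvalue b k + κ := by
  obtain ⟨p, hp⟩ := exists_jacobiBasis hb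
  obtain ⟨T, hT⟩ := exists_mulCoordinate b
  have hTs : ∀ v w, inner ℝ (T v) w = inner ℝ v (T w) := by
    intro v w
    rw [L2.inner_def, L2.inner_def]
    refine integral_congr_ae ?_
    filter_upwards [hT v, hT w] with t h1 h2
    rw [h1, h2]
    simp; ring
  have hTi : ∀ v, inner ℝ (T v) v = ∫ t, t * v t ^ 2 ∂jacobiMeasure b := by
    intro v
    rw [L2.inner_def]
    refine integral_congr_ae ?_
    filter_upwards [hT v] with t h1
    rw [h1]
    simp; ring
  have hvi : ∀ v : Lp ℝ 2 (jacobiMeasure b), ‖v‖ ^ 2 = ∫ t, v t ^ 2 ∂jacobiMeasure b := by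
    intro v
    rw [← real_inner_self_eq_norm_sq, L2.inner_def]
    simp [sq]
  have hT0 : ∀ v, 0 ≤ inner ℝ (T v) v := by
    intro v
    rw [hTi]
    refine integral_nonneg_of_ae ?_
    filter_upwards [ae_jacobiMeasure_mem_Ioo] with t ht
    exact mul_nonneg ht.1.le (sq_nonneg _)
  have hT1 : ∀ v, inner ℝ (T v) v ≤ ‖v‖ ^ 2 := by
    intro v
    rw [hTi, hvi]
    refine integral_mono_of_nonneg ?_ (Lp.memLp v).integrable_sq ?_
    · filter_upwards [ae_jacobiMeasure_mem_Ioo] with t ht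
      exact mul_nonneg ht.1.le (sq_nonneg _)
    · filter_upwards [ae_jacobiMeasure_mem_Ioo] with t ht
      exact mul_le_of_le_one_left (sq_nonneg _) ht.2.le
  have hTm : ∀ n v, inner ℝ (monomialLp hb n) (T v) = inner ℝ (monomialLp hb (n + 1)) v := by
    intro n v
    rw [inner_monomialLp, inner_monomialLp]
    refine integral_congr_ae ?_
    filter_upwards [hT v] with t h1
    rw [h1, pow_succ, mul_assoc]
  have hweak : ∀ l v, IsWeakEigenvector p (jacobiEigenvalue b) (κ • T) l v ↔
      SatisfiesMomentEquation b κ l v := by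
    intro l v
    have h1 : SatisfiesMomentEquation b κ l v ↔ ∀ n,
        ((jacobiEigenvalue b n * inner ℝ (monomialLp hb n) v
          - jacobiLower b n * inner ℝ (monomialLp hb (n - 1)) v)
          + κ * inner ℝ (monomialLp hb n) (T v)) - l * inner ℝ (monomialLp hb n) v = 0 := by
      refine forall_congr' fun n => ?_
      rw [hTm, inner_monomialLp, inner_monomialLp, inner_monomialLp]
      constructor <;> intro h <;> linear_combination h
    rw [h1, ← forall_jacobiCoeff_sum_eq_zero_iff hb]
    refine forall_congr' fun n => ?_
    have hn : ‖jacobiLp hb n‖⁻¹ ≠ 0 := inv_ne_zero (norm_ne_zero_iff.2 (jacobiLp_ne_zero hb n))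
    have e1 := jacobiEigenvalue_mul_inner_jacobiLp hb n v
    have e2 := inner_jacobiLp hb n (T v)
    have e3 := inner_jacobiLp hb n v
    have e4 : ∑ j ∈ Finset.range (n + 1), jacobiCoeff b n j *
        (((jacobiEigenvalue b j * inner ℝ (monomialLp hb j) v
          - jacobiLower b j * inner ℝ (monomialLp hb (j - 1)) v)
          + κ * inner ℝ (monomialLp hb j) (T v)) - l * inner ℝ (monomialLp hb j) v)
        = jacobiEigenvalue b n * inner ℝ (jacobiLp hb n) v + κ * inner ℝ (jacobiLp hb n) (T v)
          - l * inner ℝ (jacobiLp hb n) v := by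
      rw [e1, e2, e3, Finset.mul_sum, Finset.mul_sum, ← Finset.sum_add_distrib,
        ← Finset.sum_sub_distrib]
      exact Finset.sum_congr rfl fun j _ => by ring
    rw [e4, hp]
    simp only [smul_apply, inner_smul_left, inner_smul_right, RCLike.conj_to_real]
    constructor
    · intro h
      apply mul_left_cancel₀ hn
      linear_combination h
    · intro h
      linear_combination ‖jacobiLp hb n‖⁻¹ * h
  obtain ⟨χ, hχ, hr, hχk⟩ := exists_strictMono_weakEigenvalues (p := p)
    (δ := jacobiEigenvalue b) (B := κ • T) (β := κ)
    (fun v w => by simp [inner_smul_left, inner_smul_right, hTs])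
    (fun v => by
      rw [smul_apply, inner_smul_left]; exact mul_nonneg hκ.le (hT0 v))
    (fun v => by
      rw [smul_apply, inner_smul_left]; exact mul_le_mul_of_nonneg_left (hT1 v) hκ.le)
    (by simp [jacobiEigenvalue]) (jacobiEigenvalue_strictMono hb).monotone
    (tendsto_jacobiEigenvalue hb) (by
      intro l v w hv hw hv0
      have hv' := (hweak l v).1 hv
      -- This multiple matches the zeroth moments, so every moment of `w - c • v` vanishes.
      set c := inner ℝ (monomialLp hb 0) w / inner ℝ (monomialLp hb 0) v with hc
      have hne : inner ℝ (monomialLp hb 0) v ≠ 0 := by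
        intro h0
        rw [inner_monomialLp] at h0
        refine hv0 (eq_zero_of_inner_monomialLp_eq_zero hb fun n => ?_)
        rw [inner_monomialLp]
        exact hv'.moment_eq_zero hκ.ne' (by simpa using h0) n
      refine ⟨c, sub_eq_zero.1 (eq_zero_of_inner_monomialLp_eq_zero hb fun n => ?_)⟩
      have hd : IsWeakEigenvector p (jacobiEigenvalue b) (κ • T) l (w - c • v) := by
        intro n
        simp only [map_sub, map_smul, inner_sub_right, inner_smul_right]
        linear_combination hw n - c * hv n
      rw [inner_monomialLp]
      refine ((hweak l _).1 hd).moment_eq_zero hκ.ne' ?_ n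
      have h0 : inner ℝ (monomialLp hb 0) (w - c • v) = 0 := by
        rw [inner_sub_right, inner_smul_right, hc]
        field_simp
        ring
      rw [inner_monomialLp] at h0
      simpa using h0)
  refine ⟨χ, hχ, hr.trans ?_, hχk⟩
  ext l
  constructor
  · rintro ⟨v, hv0, hv⟩
    exact ⟨v, Lp.memLp v, fun h => hv0 (Lp.eq_zero_iff_ae_eq_zero.2 h), (hweak l v).1 hv⟩
  · rintro ⟨v, hv, hv0, hvm⟩
    have hae := hv.coeFn_toLp
    refine ⟨hv.toLp v, fun h => hv0 ?_, (hweak l _).2 fun n => ?_⟩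
    · rw [Lp.eq_zero_iff_ae_eq_zero] at h
      exact hae.symm.trans h
    · have : ∀ n : ℕ, ∫ t, t ^ n * hv.toLp v t ∂jacobiMeasure b
          = ∫ t, t ^ n * v t ∂jacobiMeasure b := by
        intro n
        refine integral_congr_ae ?_
        filter_upwards [hae] with t ht
        rw [ht]
      simp only [this]
      exact hvm n

/-! ### Separation of variables for the operator on the ball. -/

namespace BallPSWF

section Calculus

variable {d : ℕ}

local notation "𝔼" => EuclideanSpace ℝ (Fin d)

theorem pd_congr {f g : 𝔼 → ℝ} {x : 𝔼} (h : f =ᶠ[𝓝 x] g) (i : Fin d) : pd i f x = pd i g x := by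
  rw [pd, pd, h.fderiv_eq]

theorem pd_eq {f : 𝔼 → ℝ} {f' : 𝔼 →L[ℝ] ℝ} {x : 𝔼} (h : HasFDerivAt f f' x) (i : Fin d) :
    pd i f x = f' (EuclideanSpace.single i 1) := by
  rw [pd, h.fderiv]

theorem pd_add {f g : 𝔼 → ℝ} {x : 𝔼} (hf : DifferentiableAt ℝ f x) (hg : DifferentiableAt ℝ g x)
    (i : Fin d) : pd i (fun y => f y + g y) x = pd i f x + pd i g x := by
  have h : HasFDerivAt (fun y => f y + g y) _ x := hf.hasFDerivAt.add hg.hasFDerivAt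
  rw [pd_eq h]
  rfl

theorem pd_mul {f g : 𝔼 → ℝ} {x : 𝔼} (hf : DifferentiableAt ℝ f x) (hg : DifferentiableAt ℝ g x)
    (i : Fin d) : pd i (fun y => f y * g y) x = pd i f x * g x + f x * pd i g x := by
  have h : HasFDerivAt (fun y => f y * g y) _ x := hf.hasFDerivAt.mul hg.hasFDerivAt
  rw [pd_eq h]
  simp [pd]
  ring

theorem hasFDerivAt_coord (x : 𝔼) (i : Fin d) :
    HasFDerivAt (fun y : 𝔼 => y i) (EuclideanSpace.proj i : 𝔼 →L[ℝ] ℝ) x :=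
  (EuclideanSpace.proj i : 𝔼 →L[ℝ] ℝ).hasFDerivAt

theorem contDiff_eval (P : MvPolynomial (Fin d) ℝ) {n : WithTop ℕ∞} :
    ContDiff ℝ n fun y : 𝔼 => MvPolynomial.eval (fun i => y i) P := by
  induction P using MvPolynomial.induction_on with
  | C a => simpa using contDiff_const
  | add p q hp hq => simpa using hp.add hq
  | mul_X p i hp =>
    simpa using hp.mul (EuclideanSpace.proj i : 𝔼 →L[ℝ] ℝ).contDiff

theorem differentiableAt_eval (P : MvPolynomial (Fin d) ℝ) (x : 𝔼) :
    DifferentiableAt ℝ (fun y : 𝔼 => MvPolynomial.eval (fun i => y i) P) x :=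
  ((contDiff_eval P (n := 1)).differentiable one_ne_zero) x

theorem pd_eval (P : MvPolynomial (Fin d) ℝ) (x : 𝔼) (i : Fin d) :
    pd i (fun y : 𝔼 => MvPolynomial.eval (fun i => y i) P) x
      = MvPolynomial.eval (fun i => x i) (MvPolynomial.pderiv i P) := by
  induction P using MvPolynomial.induction_on with
  | C a => simp [pd]
  | add p q hp hq =>
    simp only [map_add]
    rw [pd_add (differentiableAt_eval p x) (differentiableAt_eval q x), hp, hq]
  | mul_X p j hp =>
    simp only [map_mul, MvPolynomial.eval_X]
    rw [pd_mul (differentiableAt_eval p x) (hasFDerivAt_coord x j).differentiableAt, hp,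
      pd_eq (hasFDerivAt_coord x j), MvPolynomial.pderiv_mul, MvPolynomial.pderiv_X]
    by_cases h : j = i
    · subst h; simp
    · simp [h]

theorem hasFDerivAt_radial {G : ℝ → ℝ} {g : ℝ} {x : 𝔼} (hG : HasDerivAt G g (‖x‖ ^ 2)) :
    HasFDerivAt (fun y : 𝔼 => G (‖y‖ ^ 2)) (g • (2 • innerSL ℝ x)) x :=
  hG.comp_hasFDerivAt x (hasStrictFDerivAt_norm_sq x).hasFDerivAt

/-- The product of a radial function of the squared norm with a polynomial. -/
noncomputable def radialMul (G : ℝ → ℝ) (P : MvPolynomial (Fin d) ℝ) (x : 𝔼) : ℝ :=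
  G (‖x‖ ^ 2) * MvPolynomial.eval (fun i => x i) P

theorem differentiableAt_radialMul {G : ℝ → ℝ} {g : ℝ} {x : 𝔼} (hG : HasDerivAt G g (‖x‖ ^ 2))
    (P : MvPolynomial (Fin d) ℝ) : DifferentiableAt ℝ (radialMul G P) x :=
  (hasFDerivAt_radial hG).differentiableAt.mul (differentiableAt_eval P x)

theorem pd_radialMul {G : ℝ → ℝ} {g : ℝ} {x : 𝔼} (hG : HasDerivAt G g (‖x‖ ^ 2))
    (P : MvPolynomial (Fin d) ℝ) (i : Fin d) :
    pd i (radialMul G P) x = 2 * x i * g * MvPolynomial.eval (fun i => x i) P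
      + G (‖x‖ ^ 2) * MvPolynomial.eval (fun i => x i) (MvPolynomial.pderiv i P) := by
  have h : pd i (radialMul G P) x = _ :=
    pd_mul (hasFDerivAt_radial hG).differentiableAt (differentiableAt_eval P x) i
  rw [h, pd_eval, pd_eq (hasFDerivAt_radial hG)]
  simp [EuclideanSpace.inner_single_right]
  left
  ring

/-- The angular derivative of a polynomial. -/
noncomputable def polyAngularD (i j : Fin d) (P : MvPolynomial (Fin d) ℝ) :
    MvPolynomial (Fin d) ℝ :=
  MvPolynomial.X j * MvPolynomial.pderiv i P - MvPolynomial.X i * MvPolynomial.pderiv j P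

/-- Rotation fields annihilate radial functions: the terms `xⱼ xᵢ` and `xᵢ xⱼ` cancel. -/
theorem angularD_radialMul {G : ℝ → ℝ} {g : ℝ} {x : 𝔼} (hG : HasDerivAt G g (‖x‖ ^ 2))
    (P : MvPolynomial (Fin d) ℝ) (i j : Fin d) :
    angularD i j (radialMul G P) x = radialMul G (polyAngularD i j P) x := by
  simp only [angularD, pd_radialMul hG, radialMul, polyAngularD, map_sub, map_mul,
    MvPolynomial.eval_X]
  ring

theorem two_mul_sum_filter_lt {ι : Type*} [Fintype ι] [LinearOrder ι] (T : ι → ι → ℝ)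
    (hT : ∀ i j, T i j = T j i) :
    2 * ∑ i, ∑ j ∈ Finset.univ.filter (fun j => j < i), T i j
      = ∑ i, ∑ j, T i j - ∑ i, T i i := by
  have h1 : ∑ i, ∑ j ∈ Finset.univ.filter (fun j => j < i), T i j
      = ∑ i, ∑ j ∈ Finset.univ.filter (fun j => i < j), T i j := by
    simp only [Finset.sum_filter]
    rw [Finset.sum_comm]
    exact Finset.sum_congr rfl fun i _ => Finset.sum_congr rfl fun j _ => by rw [hT j i]
  rw [two_mul]
  nth_rewrite 2 [h1]
  rw [eq_sub_iff_add_eq, ← Finset.sum_add_distrib, ← Finset.sum_add_distrib]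
  refine Finset.sum_congr rfl fun i _ => ?_
  have h2 : T i i = ∑ j, if j = i then T i j else 0 := by simp
  rw [h2, Finset.sum_filter, Finset.sum_filter, ← Finset.sum_add_distrib,
    ← Finset.sum_add_distrib]
  refine Finset.sum_congr rfl fun j _ => ?_
  rcases lt_trichotomy i j with h | rfl | h
  · simp [h, h.not_gt, h.ne']
  · simp
  · simp [h, h.not_gt, h.ne]

section Harmonic

variable {m : ℕ} {P : MvPolynomial (Fin d) ℝ}

theorem sum_mul_eval_pderiv (hP : P.IsHomogeneous m) (x : Fin d → ℝ) :
    ∑ i, x i * MvPolynomial.eval x (MvPolynomial.pderiv i P) = m * MvPolynomial.eval x P := by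
  have := congrArg (MvPolynomial.eval x) hP.sum_X_mul_pderiv
  simpa [map_sum] using this

/-- Differentiate Euler's identity, then apply it again. -/
theorem sum_sum_mul_eval_pderiv (hP : P.IsHomogeneous m) (x : Fin d → ℝ) :
    ∑ i, ∑ j, x i * x j *
        MvPolynomial.eval x (MvPolynomial.pderiv i (MvPolynomial.pderiv j P))
      = m * (m - 1) * MvPolynomial.eval x P := by
  have h : ∀ i, ∑ j, x j * MvPolynomial.eval x (MvPolynomial.pderiv i (MvPolynomial.pderiv j P))
      = (m - 1) * MvPolynomial.eval x (MvPolynomial.pderiv i P) := by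
    intro i
    have := congrArg (fun Q => MvPolynomial.eval x (MvPolynomial.pderiv i Q)) hP.sum_X_mul_pderiv
    simp only [map_sum, MvPolynomial.pderiv_mul, MvPolynomial.pderiv_X, map_add, map_mul,
      MvPolynomial.eval_X, Finset.sum_add_distrib, Pi.single_apply, nsmul_eq_mul,
      apply_ite (MvPolynomial.eval x), map_zero, ite_mul, one_mul, zero_mul] at this
    simp at this
    linear_combination this
  simp only [mul_assoc, ← Finset.mul_sum, h]
  have := sum_mul_eval_pderiv hP x
  simp only [mul_left_comm _ ((m : ℝ) - 1), ← Finset.mul_sum, this]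

theorem sum_eval_pderiv_pderiv (hP : IsHarmonicHomogeneous m P) (x : Fin d → ℝ) :
    ∑ i, MvPolynomial.eval x (MvPolynomial.pderiv i (MvPolynomial.pderiv i P)) = 0 := by
  have := congrArg (MvPolynomial.eval x) hP.2
  simpa [map_sum] using this

/-- Spherical harmonics of degree `m` are eigenfunctions of the angular Laplacian. -/
theorem sum_polyAngularD (hP : IsHarmonicHomogeneous m P) (x : Fin d → ℝ) :
    ∑ i : Fin d, ∑ j ∈ Finset.univ.filter (fun j : Fin d => j < i),
        MvPolynomial.eval x (polyAngularD i j (polyAngularD i j P))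
      = -(m * (m + d - 2)) * MvPolynomial.eval x P := by
  set e := MvPolynomial.eval x with he
  -- `T` is the expansion of `D_{ij}² P` for `i ≠ j`. On the diagonal it equals `-2 xᵢ ∂ᵢ P` instead
  -- of zero; the halved symmetric sum subtracts this.
  let T : Fin d → Fin d → ℝ := fun i j =>
    x j ^ 2 * e (MvPolynomial.pderiv i (MvPolynomial.pderiv i P))
      + x i ^ 2 * e (MvPolynomial.pderiv j (MvPolynomial.pderiv j P))
      - x i * x j * e (MvPolynomial.pderiv i (MvPolynomial.pderiv j P))
      - x j * x i * e (MvPolynomial.pderiv j (MvPolynomial.pderiv i P))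
      - x j * e (MvPolynomial.pderiv j P) - x i * e (MvPolynomial.pderiv i P)
  have hT : ∀ i j, T i j = T j i := fun i j => by simp only [T]; ring
  have hTe : ∀ i j, j < i → e (polyAngularD i j (polyAngularD i j P)) = T i j := by
    intro i j hij
    simp only [polyAngularD, T, he, map_sub, map_mul, MvPolynomial.pderiv_mul, map_add,
      MvPolynomial.pderiv_X_self, MvPolynomial.pderiv_X_of_ne hij.ne,
      MvPolynomial.pderiv_X_of_ne hij.ne', MvPolynomial.eval_X, map_one, map_zero]
    ring
  have h1 : ∑ i : Fin d, ∑ j ∈ Finset.univ.filter (fun j : Fin d => j < i),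
        e (polyAngularD i j (polyAngularD i j P))
      = ∑ i : Fin d, ∑ j ∈ Finset.univ.filter (fun j : Fin d => j < i), T i j :=
    Finset.sum_congr rfl fun i _ => Finset.sum_congr rfl fun j hj =>
      hTe i j (Finset.mem_filter.1 hj).2
  rw [h1]
  have h2 := two_mul_sum_filter_lt T hT
  have e1 := sum_mul_eval_pderiv hP.1 x
  have e2 := sum_sum_mul_eval_pderiv hP.1 x
  have e3 := sum_eval_pderiv_pderiv hP x
  have e4 := e2
  rw [Finset.sum_comm] at e4
  simp only [← he] at e1 e2 e3 e4
  have hd : ∑ i, T i i = -2 * (m * e P) := by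
    rw [← e1, Finset.mul_sum]
    exact Finset.sum_congr rfl fun i _ => by simp only [T, he]; ring
  have hs : ∑ i, ∑ j, T i j = -2 * (m * (m - 1) * e P) - 2 * (d * (m * e P)) := by
    simp only [T, Finset.sum_sub_distrib, Finset.sum_add_distrib]
    rw [e2, e4]
    simp only [← Finset.mul_sum, ← Finset.sum_mul, Finset.sum_const, Finset.card_univ,
      Fintype.card_fin, nsmul_eq_mul]
    have e5 : ∑ i, x i * ((d : ℝ) * e (MvPolynomial.pderiv i P)) = d * (m * e P) := by
      rw [← e1, Finset.mul_sum]
      exact Finset.sum_congr rfl fun i _ => by ring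
    simp only [e3, e1, e5, mul_zero]
    ring
  rw [hs, hd] at h2
  linear_combination h2 / 2

end Harmonic

/-- The operator on separated functions: its radial part is a Jacobi operator. -/
theorem sturmLiouville_radialMul {c : ℝ} {m : ℕ} {P : MvPolynomial (Fin d) ℝ}
    (hP : IsHarmonicHomogeneous m P) {G G₁ : ℝ → ℝ} {g₂ : ℝ} {x : 𝔼} {ψ : 𝔼 → ℝ}
    (hψ : ψ =ᶠ[𝓝 x] radialMul G P)
    (hG : ∀ᶠ t in 𝓝 (‖x‖ ^ 2), HasDerivAt G (G₁ t) t) (hG₁ : HasDerivAt G₁ g₂ (‖x‖ ^ 2)) :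
    sturmLiouville c ψ x =
      (-4 * (‖x‖ ^ 2 * (1 - ‖x‖ ^ 2) * g₂
          + ((d / 2 + m) - (d / 2 + m + 1) * ‖x‖ ^ 2) * G₁ (‖x‖ ^ 2))
        + m * (m + d) * G (‖x‖ ^ 2) + c ^ 2 * ‖x‖ ^ 2 * G (‖x‖ ^ 2))
      * MvPolynomial.eval (fun i => x i) P := by
  have hcont : Tendsto (fun y : 𝔼 => ‖y‖ ^ 2) (𝓝 x) (𝓝 (‖x‖ ^ 2)) :=
    (continuous_norm.pow 2).tendsto x
  have hGx := hG.self_of_nhds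
  have hpd : ∀ i, pd i ψ =ᶠ[𝓝 x] fun y =>
      2 * y i * G₁ (‖y‖ ^ 2) * MvPolynomial.eval (fun i => y i) P
      + G (‖y‖ ^ 2) * MvPolynomial.eval (fun i => y i) (MvPolynomial.pderiv i P) := by
    intro i
    filter_upwards [hψ.eventuallyEq_nhds, hcont.eventually hG] with y h1 h2
    rw [pd_congr h1, pd_radialMul h2]
  set t := ‖x‖ ^ 2 with ht
  have hK : HasDerivAt (fun t => (1 - t) * G t) (-G t + (1 - t) * G₁ t) t := 
    (((hasDerivAt_id t).const_sub 1).mul hGx).congr_deriv (by simp)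
  have hK₁ : HasDerivAt (fun t => (1 - t) * G₁ t) (-G₁ t + (1 - t) * g₂) t := 
    (((hasDerivAt_id t).const_sub 1).mul hG₁).congr_deriv (by simp)
  have hdiv : ∀ i, pd i (fun y => (1 - ‖y‖ ^ 2) * pd i ψ y) x
      = 2 * x i * (-G₁ t + (1 - t) * g₂) * (2 * x i * MvPolynomial.eval (fun i => x i) P)
        + (1 - t) * G₁ t * (2 * (MvPolynomial.eval (fun i => x i) P
          + x i * MvPolynomial.eval (fun i => x i) (MvPolynomial.pderiv i P)))
        + (2 * x i * (-G t + (1 - t) * G₁ t) *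
            MvPolynomial.eval (fun i => x i) (MvPolynomial.pderiv i P)
          + (1 - t) * G t * MvPolynomial.eval (fun i => x i)
            (MvPolynomial.pderiv i (MvPolynomial.pderiv i P))) := by
    intro i
    -- The flux component is again a sum of radial functions times polynomials, so `pd_radialMul`
    -- applies once more.
    have h1 : (fun y => (1 - ‖y‖ ^ 2) * pd i ψ y) =ᶠ[𝓝 x] fun y =>
        radialMul (fun t => (1 - t) * G₁ t) (2 * (MvPolynomial.X i * P)) y
          + radialMul (fun t => (1 - t) * G t) (MvPolynomial.pderiv i P) y := by
      filter_upwards [hpd i] with y hy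
      rw [hy]
      simp only [radialMul, map_mul, MvPolynomial.eval_X, map_ofNat]
      ring
    rw [pd_congr h1, pd_add (differentiableAt_radialMul hK₁ _) (differentiableAt_radialMul hK _),
      pd_radialMul hK₁, pd_radialMul hK]
    have h2 : MvPolynomial.pderiv i (2 * (MvPolynomial.X i * P))
        = 2 * (P + MvPolynomial.X i * MvPolynomial.pderiv i P) := by
      rw [two_mul, map_add, ← two_mul, MvPolynomial.pderiv_mul, MvPolynomial.pderiv_X_self,
        one_mul]
    rw [h2]
    simp only [map_mul, map_add, MvPolynomial.eval_X, map_ofNat]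
    ring
  have hsum : ∑ i, pd i (fun y => (1 - ‖y‖ ^ 2) * pd i ψ y) x
      = (4 * t * (-G₁ t + (1 - t) * g₂) + 2 * (d + m) * ((1 - t) * G₁ t)
        + 2 * m * (-G t + (1 - t) * G₁ t)) * MvPolynomial.eval (fun i => x i) P := by
    have e1 := sum_mul_eval_pderiv hP.1 (fun i => x i)
    have e3 := sum_eval_pderiv_pderiv hP (fun i => x i)
    have e0 : ∑ i, x i ^ 2 = t := by rw [ht, EuclideanSpace.real_norm_sq_eq]
    set e := MvPolynomial.eval (fun i => x i) P
    have hr : ∀ i, pd i (fun y => (1 - ‖y‖ ^ 2) * pd i ψ y) x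
        = 4 * (-G₁ t + (1 - t) * g₂) * e * x i ^ 2 + 2 * (1 - t) * G₁ t * e
          + (2 * (1 - t) * G₁ t + 2 * (-G t + (1 - t) * G₁ t)) *
            (x i * MvPolynomial.eval (fun i => x i) (MvPolynomial.pderiv i P))
          + (1 - t) * G t * MvPolynomial.eval (fun i => x i)
            (MvPolynomial.pderiv i (MvPolynomial.pderiv i P)) := fun i => by rw [hdiv]; ring
    simp only [hr, Finset.sum_add_distrib, ← Finset.mul_sum, e0, e1, e3, Finset.sum_const,
      Finset.card_univ, Fintype.card_fin, nsmul_eq_mul]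
    ring
  have hang : angularLaplacian ψ x
      = G t * (-(m * (m + d - 2)) * MvPolynomial.eval (fun i => x i) P) := by
    rw [← sum_polyAngularD hP, angularLaplacian, Finset.mul_sum]
    refine Finset.sum_congr rfl fun i _ => ?_
    rw [Finset.mul_sum]
    refine Finset.sum_congr rfl fun j _ => ?_
    have h1 : angularD i j ψ =ᶠ[𝓝 x] radialMul G (polyAngularD i j P) := by
      filter_upwards [hψ.eventuallyEq_nhds, hcont.eventually hG] with y h1 h2
      rw [← angularD_radialMul h2, angularD, angularD, pd_congr h1, pd_congr h1]
    have h2 : angularD i j (angularD i j ψ) x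
        = angularD i j (radialMul G (polyAngularD i j P)) x := by
      rw [angularD, angularD, pd_congr h1, pd_congr h1]
    rw [h2, angularD_radialMul hGx, radialMul]
  have hx : ψ x = G t * MvPolynomial.eval (fun i => x i) P := hψ.self_of_nhds
  rw [sturmLiouville, hsum, hang, hx]
  ring

end Calculus

end BallPSWF

/-! ### Power series with exponentially decaying coefficients. -/

section EntireSeries

/-- The sum of the power series with coefficients `a`. -/
noncomputable def powerSum (a : ℕ → ℝ) (t : ℝ) : ℝ := ∑' n, a n * t ^ n

/-- The coefficients of the derivative of a power series. -/
def derivCoeff (a : ℕ → ℝ) (n : ℕ) : ℝ := (n + 1) * a (n + 1)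

/-- Coefficients that decay like those of the exponential series. -/
def ExpDecay (a : ℕ → ℝ) : Prop :=
  ∃ C K : ℝ, 0 ≤ C ∧ 0 ≤ K ∧ ∀ n, |a n| ≤ C * (K ^ n / n.factorial)

namespace ExpDecay

variable {a : ℕ → ℝ}

theorem derivCoeff (ha : ExpDecay a) : ExpDecay (derivCoeff a) := by
  obtain ⟨C, K, hC, hK, h⟩ := ha
  refine ⟨C * K, K, by positivity, hK, fun n => ?_⟩
  rw [_root_.derivCoeff, abs_mul, abs_of_nonneg (by positivity : (0 : ℝ) ≤ n + 1)]
  refine (mul_le_mul_of_nonneg_left (h (n + 1)) (by positivity)).trans_eq ?_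
  rw [Nat.factorial_succ]
  push_cast
  field_simp
  ring

theorem norm_term_le (ha : ExpDecay a) :
    ∃ C K : ℝ, 0 ≤ C ∧ 0 ≤ K ∧ ∀ (R t : ℝ), |t| ≤ R → ∀ n,
      ‖a n * t ^ n‖ ≤ C * ((K * R) ^ n / n.factorial) := by
  obtain ⟨C, K, hC, hK, h⟩ := ha
  refine ⟨C, K, hC, hK, fun R t ht n => ?_⟩
  rw [norm_mul, norm_pow, Real.norm_eq_abs, Real.norm_eq_abs]
  calc |a n| * |t| ^ n ≤ C * (K ^ n / n.factorial) * R ^ n :=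
        mul_le_mul (h n) (pow_le_pow_left₀ (abs_nonneg _) ht n) (by positivity) (by positivity)
    _ = _ := by rw [mul_pow]; ring

theorem summable (ha : ExpDecay a) (t : ℝ) : Summable fun n => a n * t ^ n := by
  obtain ⟨C, K, -, -, h⟩ := ha.norm_term_le
  exact Summable.of_norm_bounded ((Real.summable_pow_div_factorial (K * |t|)).mul_left C)
    (h |t| t le_rfl)

theorem hasSum (ha : ExpDecay a) (t : ℝ) : HasSum (fun n => a n * t ^ n) (powerSum a t) :=
  (ha.summable t).hasSum

theorem hasDerivAt (ha : ExpDecay a) (t : ℝ) :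
    HasDerivAt (powerSum a) (powerSum (_root_.derivCoeff a) t) t := by
  obtain ⟨C, K, hC, hK, h⟩ := ha.derivCoeff.norm_term_le
  set R := |t| + 1
  have hshift : powerSum (_root_.derivCoeff a) t = ∑' n, a n * (n * t ^ (n - 1)) := by
    have hs : HasSum (fun n => a (n + 1) * (((n + 1 : ℕ) : ℝ) * t ^ (n + 1 - 1)))
        (powerSum (_root_.derivCoeff a) t) := by
      convert ha.derivCoeff.hasSum t using 2 with n
      simp only [_root_.derivCoeff, Nat.add_sub_cancel]
      push_cast
      ring
    have := (hasSum_nat_add_iff (f := fun n => a n * (n * t ^ (n - 1))) 1).1 hs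
    simpa using this.tsum_eq.symm
  rw [hshift]
  -- Termwise differentiation on the ball of radius `|t| + 1`, dominated by an exponential series.
  refine hasDerivAt_tsum_of_isPreconnected
    (u := fun n => if n = 0 then 0 else C * ((K * R) ^ (n - 1) / (n - 1).factorial))
    (t := Metric.ball 0 R) (y₀ := t) ?_ Metric.isOpen_ball
    (convex_ball (0 : ℝ) R).isPreconnected (fun n y _ => (hasDerivAt_pow n y).const_mul (a n))
    (fun n y hy => ?_) (by simp [R]) (ha.summable t) (by simp [R])
  · rw [← summable_nat_add_iff 1]
    simpa using (Real.summable_pow_div_factorial (K * R)).mul_left C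
  · rcases n with _ | n
    · simp
    · have hy' : |y| ≤ R := by
        have := mem_ball_zero_iff.1 hy
        exact this.le
      have := h R y hy' n
      simp only [Nat.add_sub_cancel, Nat.succ_ne_zero, if_false]
      refine le_trans (le_of_eq ?_) this
      simp only [_root_.derivCoeff]
      congr 1
      push_cast
      ring

theorem contDiff (ha : ExpDecay a) (n : ℕ) : ContDiff ℝ n (powerSum a) := by
  induction n generalizing a with
  | zero =>
    rw [Nat.cast_zero, contDiff_zero]
    exact continuous_iff_continuousAt.2 fun t => (ha.hasDerivAt t).continuousAt
  | succ n ih =>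
    rw [Nat.cast_add, Nat.cast_one, contDiff_succ_iff_deriv]
    refine ⟨fun t => (ha.hasDerivAt t).differentiableAt, fun h => by simp at h, ?_⟩
    rw [show deriv (powerSum a) = powerSum (_root_.derivCoeff a) from
      funext fun t => (ha.hasDerivAt t).deriv]
    exact ih ha.derivCoeff

end ExpDecay

/-- Multiplying a power series by the variable shifts its coefficients. -/
theorem hasSum_mul_self {a c : ℕ → ℝ} {t S : ℝ} (h : HasSum (fun n => a n * t ^ n) S)
    (h0 : c 0 = 0) (hc : ∀ n, c (n + 1) = a n) : HasSum (fun n => c n * t ^ n) (t * S) := by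
  have hs : HasSum (fun n => c (n + 1) * t ^ (n + 1)) (t * S) := by
    have h1 : (fun n => c (n + 1) * t ^ (n + 1)) = fun n => t * (a n * t ^ n) :=
      funext fun n => by rw [hc]; ring
    rw [h1]
    exact h.mul_left t
  have := (hasSum_nat_add_iff (f := fun n => c n * t ^ n) 1).1 hs
  simpa [h0] using this

end EntireSeries

/-! ### From moments to an entire solution. -/

/-- The coefficients relating moments to Taylor coefficients. -/
noncomputable def momentWeight (b κ : ℝ) (n : ℕ) : ℝ :=
  ∏ i ∈ Finset.range n, (-κ / jacobiLower b (i + 1))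

theorem momentWeight_succ {b κ : ℝ} (hb : 0 < b) (n : ℕ) :
    jacobiLower b (n + 1) * momentWeight b κ (n + 1) = -κ * momentWeight b κ n := by
  rw [momentWeight, Finset.prod_range_succ, ← momentWeight]
  have := jacobiLower_succ_ne_zero hb n
  field_simp

/-- Use only `n + b ≥ b` in each factor; one factorial suffices for convergence everywhere. -/
theorem abs_momentWeight_le {b κ : ℝ} (hb : 0 < b) (hκ : 0 < κ) (n : ℕ) :
    |momentWeight b κ n| ≤ (κ / (4 * b)) ^ n / n.factorial := by
  induction n with
  | zero => simp [momentWeight]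
  | succ n ih =>
    rw [momentWeight, Finset.prod_range_succ, ← momentWeight, abs_mul, pow_succ,
      Nat.factorial_succ]
    have h1 : |-κ / jacobiLower b (n + 1)| ≤ κ / (4 * b) / (n + 1) := by
      have : jacobiLower b (n + 1) = 4 * (n + 1) * (n + b) := by
        simp only [jacobiLower]; push_cast; ring
      rw [this, abs_div, abs_neg, abs_of_pos hκ, abs_of_pos (by positivity), div_div]
      refine div_le_div_of_nonneg_left hκ.le (by positivity) ?_
      have := n.cast_nonneg (α := ℝ)
      nlinarith [mul_nonneg this this]
    refine (mul_le_mul ih h1 (abs_nonneg _) (by positivity)).trans_eq ?_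
    push_cast
    field_simp

/-- A solution of the moment equation yields an entire solution of the differential equation. -/
theorem exists_entire_solution {b κ l : ℝ} (hb : 0 < b) (hκ : 0 < κ) {v : ℝ → ℝ}
    (hv : MemLp v 2 (jacobiMeasure b)) (hv0 : ¬ v =ᵐ[jacobiMeasure b] 0)
    (hm : SatisfiesMomentEquation b κ l v) :
    ∃ u u₁ u₂ : ℝ → ℝ, u 0 ≠ 0 ∧ ContDiff ℝ 2 u ∧ (∀ t, HasDerivAt u (u₁ t) t) ∧
      (∀ t, HasDerivAt u₁ (u₂ t) t) ∧
      ∀ t, -4 * (t * (1 - t) * u₂ t + (b - (b + 1) * t) * u₁ t) + κ * t * u t = l * u t := by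
  have := isFiniteMeasure_jacobiMeasure hb
  set M : ℕ → ℝ := fun n => ∫ t, t ^ n * v t ∂jacobiMeasure b with hM
  set a : ℕ → ℝ := fun n => momentWeight b κ n * M n with ha
  have hint : Integrable v (jacobiMeasure b) := hv.integrable (by norm_num)
  have hMb : ∀ n, |M n| ≤ ∫ t, |v t| ∂jacobiMeasure b := by
    intro n
    refine abs_integral_le_integral_abs.trans (integral_mono_ae
      (integrable_pow_mul_jacobiMeasure hb n hv).abs hint.abs ?_)
    filter_upwards [ae_jacobiMeasure_mem_Ioo] with t ht
    rw [abs_mul, abs_of_nonneg (pow_nonneg ht.1.le n)]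
    exact mul_le_of_le_one_left (abs_nonneg _) (pow_le_one₀ ht.1.le ht.2.le)
  have hae : ExpDecay a := by
    refine ⟨∫ t, |v t| ∂jacobiMeasure b, κ / (4 * b), integral_nonneg fun _ => abs_nonneg _,
      by positivity, fun n => ?_⟩
    rw [ha, abs_mul, mul_comm]
    exact mul_le_mul (hMb n) (abs_momentWeight_le hb hκ n) (abs_nonneg _)
      (integral_nonneg fun _ => abs_nonneg _)
  -- Multiplying the moment equation by the weight exchanges the two neighbours: `κ M (n + 1)`
  -- becomes a multiple of `a (n + 1)`, and `jacobiLower b n * M (n - 1)` becomes `-κ a (n - 1)`.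
  -- The result is the Taylor recurrence of the differential equation.
  have hrec : ∀ n, jacobiLower b (n + 1) * a (n + 1)
      = (jacobiEigenvalue b n - l) * a n + κ * (if n = 0 then 0 else a (n - 1)) := by
    intro n
    have h1 := momentWeight_succ (κ := κ) hb n
    have h2 := hm n
    change (jacobiEigenvalue b n - l) * M n
      = jacobiLower b n * M (n - 1) - κ * M (n + 1) at h2
    simp only [ha]
    rcases n with _ | n
    · have h0 : jacobiLower b 0 = 0 := by simp [jacobiLower]
      rw [h0] at h2
      simp only [if_true]
      linear_combination M (0 + 1) * h1 - momentWeight b κ 0 * h2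
    · have h3 := momentWeight_succ (κ := κ) hb n
      simp only [Nat.add_sub_cancel, Nat.succ_ne_zero, if_false] at h2 ⊢
      linear_combination M (n + 1 + 1) * h1 - momentWeight b κ (n + 1) * h2 - M n * h3
  refine ⟨powerSum a, powerSum (derivCoeff a), powerSum (derivCoeff (derivCoeff a)), ?_,
    hae.contDiff 2, hae.hasDerivAt, hae.derivCoeff.hasDerivAt, fun t => ?_⟩
  · have h0 : powerSum a 0 = M 0 := by
      rw [powerSum, tsum_eq_single 0 fun n hn => by simp [hn]]
      simp [ha, momentWeight]
    rw [h0]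
    intro hM0
    refine hv0 (ae_eq_zero_of_moments_eq_zero hb hv fun n => hm.moment_eq_zero hκ.ne' ?_ n)
    simpa [hM] using hM0
  -- `s0`, …, `s5` expand `u`, `u'`, `t u`, `t u'`, `t u''` and `t² u''`.
  · have s0 := hae.hasSum t
    have s1 := hae.derivCoeff.hasSum t
    have s2 := hasSum_mul_self s0 (c := fun n => if n = 0 then 0 else a (n - 1)) (by simp)
      (fun n => by simp)
    have s3 := hasSum_mul_self s1 (c := fun n => n * a n) (by simp)
      (fun n => by simp [derivCoeff])
    have s4 := hasSum_mul_self (hae.derivCoeff.derivCoeff.hasSum t)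
      (c := fun n => n * ((n + 1) * a (n + 1))) (by simp)
      (fun n => by simp [derivCoeff])
    have s5 := hasSum_mul_self s4 (c := fun n => n * (n - 1) * a n) (by simp)
      (fun n => by push_cast; ring)
    have key := (((s4.sub s5).add ((s1.mul_left b).sub (s3.mul_left (b + 1)))).mul_left (-4)).add
      ((s2.mul_left κ).sub (s0.mul_left l))
    have hz : ∀ n : ℕ, -4 * ((n * ((n + 1) * a (n + 1)) * t ^ n - n * (n - 1) * a n * t ^ n)
        + (b * (derivCoeff a n * t ^ n) - (b + 1) * (n * a n * t ^ n)))
        + (κ * ((if n = 0 then 0 else a (n - 1)) * t ^ n) - l * (a n * t ^ n)) = 0 := by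
      intro n
      have := hrec n
      simp only [jacobiLower, jacobiEigenvalue] at this
      push_cast at this
      simp only [derivCoeff]
      linear_combination -t ^ n * this
    simp only [hz] at key
    have h0 := key.unique hasSum_zero
    linear_combination h0

/-! ### Harmonic polynomials, and eigenfunctions from moment solutions. -/

namespace BallPSWF

variable {d m : ℕ}

theorem eval_smul_of_isHomogeneous {P : MvPolynomial (Fin d) ℝ} (hP : P.IsHomogeneous m) (r : ℝ)
    (x : Fin d → ℝ) :
    MvPolynomial.eval (fun i => r * x i) P = r ^ m * MvPolynomial.eval x P := by
  rw [MvPolynomial.eval_eq', MvPolynomial.eval_eq', Finset.mul_sum]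
  refine Finset.sum_congr rfl fun s hs => ?_
  have hsum : ∑ i, s i = m := by
    have := hP (MvPolynomial.mem_support_iff.1 hs)
    rw [← this, Finsupp.weight_apply, Finsupp.sum_fintype] <;> simp
  simp only [mul_pow, Finset.prod_mul_distrib]
  rw [Finset.prod_pow_eq_pow_sum, hsum]
  ring

theorem sum_pderiv_pderiv_X_mul (k : Fin d) (P : MvPolynomial (Fin d) ℝ) :
    ∑ i, MvPolynomial.pderiv i (MvPolynomial.pderiv i (MvPolynomial.X k * P))
      = MvPolynomial.X k * ∑ i, MvPolynomial.pderiv i (MvPolynomial.pderiv i P)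
        + 2 * MvPolynomial.pderiv k P := by
  have h : ∀ i, MvPolynomial.pderiv i (MvPolynomial.pderiv i (MvPolynomial.X k * P))
      = MvPolynomial.X k * MvPolynomial.pderiv i (MvPolynomial.pderiv i P)
        + if i = k then 2 * MvPolynomial.pderiv k P else 0 := by
    intro i
    by_cases hik : i = k
    · subst hik
      simp only [MvPolynomial.pderiv_mul, MvPolynomial.pderiv_X_self, map_add, one_mul, if_true]
      ring
    · simp [MvPolynomial.pderiv_X_of_ne (Ne.symm hik), hik]
  simp only [h, Finset.sum_add_distrib, ← Finset.mul_sum]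
  simp

/-- `A` and `B` are the real and imaginary parts of `(xᵢ + √-1 xⱼ) ^ m`. The Cauchy–Riemann
equations are carried along because they cancel the cross terms in the Laplacian. -/
theorem exists_harmonic_pair (i j : Fin d) (hij : i ≠ j) (m : ℕ) :
    ∃ A B : MvPolynomial (Fin d) ℝ, IsHarmonicHomogeneous m A ∧ IsHarmonicHomogeneous m B ∧
      MvPolynomial.pderiv j A = -MvPolynomial.pderiv i B ∧
      MvPolynomial.pderiv j B = MvPolynomial.pderiv i A ∧
      MvPolynomial.eval (fun k => if k = i then 1 else 0) A = 1 := by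
  induction m with
  | zero =>
    exact ⟨1, 0, ⟨MvPolynomial.isHomogeneous_one _ _, by simp⟩,
      ⟨MvPolynomial.isHomogeneous_zero _ _ _, by simp⟩, by simp, by simp, by simp⟩
  | succ m ih =>
    obtain ⟨A, B, ⟨hA, hA'⟩, ⟨hB, hB'⟩, h1, h2, h3⟩ := ih
    have hX : ∀ (k : Fin d) {Q : MvPolynomial (Fin d) ℝ}, Q.IsHomogeneous m →
        (MvPolynomial.X k * Q).IsHomogeneous (m + 1) := fun k Q hQ => by
      rw [add_comm]; exact (MvPolynomial.isHomogeneous_X ℝ k).mul hQ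
    refine ⟨MvPolynomial.X i * A - MvPolynomial.X j * B, MvPolynomial.X i * B + MvPolynomial.X j * A,
      ⟨(hX i hA).sub (hX j hB), ?_⟩, ⟨(hX i hB).add (hX j hA), ?_⟩, ?_, ?_, ?_⟩
    · simp only [map_sub, Finset.sum_sub_distrib, sum_pderiv_pderiv_X_mul, hA', hB', h2]
      ring
    · simp only [map_add, Finset.sum_add_distrib, sum_pderiv_pderiv_X_mul, hA', hB', h1]
      ring
    · simp only [map_sub, map_add, MvPolynomial.pderiv_mul, MvPolynomial.pderiv_X_self,
        MvPolynomial.pderiv_X_of_ne hij, MvPolynomial.pderiv_X_of_ne hij.symm, h1, h2]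
      ring
    · simp only [map_sub, map_add, MvPolynomial.pderiv_mul, MvPolynomial.pderiv_X_self,
        MvPolynomial.pderiv_X_of_ne hij, MvPolynomial.pderiv_X_of_ne hij.symm, h1, h2]
      ring
    · simp [h3, hij.symm]

theorem exists_harmonicHomogeneous (hd : 1 ≤ d) (hm : d = 1 → m ≤ 1) :
    ∃ P : MvPolynomial (Fin d) ℝ, IsHarmonicHomogeneous m P ∧
      ∃ x : Fin d → ℝ, MvPolynomial.eval x P ≠ 0 := by
  rcases eq_or_lt_of_le hd with h | h
  · rcases Nat.le_one_iff_eq_zero_or_eq_one.1 (hm h.symm) with rfl | rfl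
    · exact ⟨1, ⟨MvPolynomial.isHomogeneous_one _ _, by simp⟩, 0, by simp⟩
    · refine ⟨MvPolynomial.X ⟨0, hd⟩, ⟨MvPolynomial.isHomogeneous_X _ _, ?_⟩, fun _ => 1, by simp⟩
      refine Finset.sum_eq_zero fun i _ => ?_
      rw [MvPolynomial.pderiv_X, Pi.single_apply]
      split_ifs <;> simp
  · obtain ⟨A, B, hA, -, -, -, h1⟩ := exists_harmonic_pair (d := d) ⟨0, hd⟩ ⟨1, h⟩ (by simp) m
    exact ⟨A, hA, _, by rw [h1]; exact one_ne_zero⟩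

/-- Eigenvalues of the moment equation are eigenvalues of the operator on the ball. -/
theorem mem_eigenvalues_of_momentEquation (hd : 1 ≤ d) (hm : d = 1 → m ≤ 1) {c : ℝ} (hc : 0 < c)
    {χ : ℝ} {v : ℝ → ℝ} (hv : MemLp v 2 (jacobiMeasure (d / 2 + m)))
    (hv0 : ¬ v =ᵐ[jacobiMeasure (d / 2 + m)] 0)
    (h : SatisfiesMomentEquation (d / 2 + m) (c ^ 2) (χ - m * (m + d)) v) :
    χ ∈ eigenvalues d m c := by
  have hd' : (1 : ℝ) ≤ d := by exact_mod_cast hd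
  have hb : (0 : ℝ) < d / 2 + m := by positivity
  obtain ⟨u, u₁, u₂, hu0, huC, hu₁, hu₂, hode⟩ :=
    exists_entire_solution hb (by positivity : 0 < c ^ 2) hv hv0 h
  obtain ⟨P, hP, y, hy⟩ := exists_harmonicHomogeneous hd hm
  refine ⟨radialMul u P, ?_, ⟨fun s => u ((s + 1) / 2), P, hP, fun x _ => ?_⟩, ?_, fun x _ => ?_⟩
  · exact ((huC.comp (contDiff_norm_sq ℝ)).mul (contDiff_eval P)).contDiffOn
  · simp only [radialMul]
    ring_nf
  -- Shrink a point where `P ≠ 0` towards the origin: homogeneity keeps `P` nonzero, and `u` stays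
  -- near `u 0 ≠ 0`.
  · let Y : EuclideanSpace ℝ (Fin d) := WithLp.toLp 2 y
    have h1 : Tendsto (fun r : ℝ => u (‖r • Y‖ ^ 2)) (𝓝 0) (𝓝 (u 0)) := by
      have : Continuous fun r : ℝ => u (‖r • Y‖ ^ 2) := by
        have := huC.continuous
        fun_prop
      simpa using this.tendsto 0
    have h2 : Tendsto (fun r : ℝ => ‖r • Y‖) (𝓝 0) (𝓝 0) := by
      have : Continuous fun r : ℝ => ‖r • Y‖ := by fun_prop
      simpa using this.tendsto 0
    have h3 : ∀ᶠ r : ℝ in 𝓝[≠] 0, r ≠ 0 ∧ u (‖r • Y‖ ^ 2) ≠ 0 ∧ ‖r • Y‖ ≤ 1 :=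
      eventually_mem_nhdsWithin.and (((h1.eventually_ne hu0).and
        (h2.eventually_le_const one_pos)).filter_mono nhdsWithin_le_nhds)
    obtain ⟨r, hr0, hr1, hr2⟩ := h3.exists
    refine ⟨r • Y, by simpa using hr2, mul_ne_zero hr1 ?_⟩
    have : MvPolynomial.eval (fun i => (r • Y) i) P = _ := eval_smul_of_isHomogeneous hP.1 r y
    rw [this]
    exact mul_ne_zero (pow_ne_zero _ hr0) hy
  · rw [sturmLiouville_radialMul hP (EventuallyEq.refl _ _)
      (Eventually.of_forall fun t => hu₁ t) (hu₂ _), radialMul]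
    linear_combination MvPolynomial.eval (fun i => x i) P * hode (‖x‖ ^ 2)

end BallPSWF

/-! ### From smooth eigenfunctions to the moment equation, along a ray. -/

namespace BallPSWF

section Radial

variable {d m : ℕ} {h : ℝ} {f f' G G₁ G₂ : ℝ → ℝ}

/-- Boundedness of `f` gives `G(t)² t ^ m ≤ C² / h²`, which leaves the weight `t ^ (d/2 - 1)`,
integrable for `d ≥ 1`. -/
theorem memLp_of_ray (hd : 1 ≤ d) (hh : h ≠ 0) (hfc : ContinuousOn f (Icc 0 1))
    (hfG : ∀ r ∈ Ioo (0 : ℝ) 1, f r = G (r ^ 2) * (r ^ m * h))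
    (hGc : ContinuousOn G (Ioo 0 1)) : MemLp G 2 (jacobiMeasure (d / 2 + m)) := by
  have hd' : (1 : ℝ) ≤ d := by exact_mod_cast hd
  obtain ⟨C, hC⟩ := isCompact_Icc.exists_bound_of_continuousOn hfc
  have hmeas : AEStronglyMeasurable G (volume.restrict (Ioo (0 : ℝ) 1)) :=
    hGc.aestronglyMeasurable measurableSet_Ioo
  have hmeas' : AEStronglyMeasurable G (jacobiMeasure (d / 2 + m)) :=
    hmeas.mono_ac (withDensity_absolutelyContinuous _ _)
  rw [memLp_two_iff_integrable_sq hmeas', integrable_jacobiMeasure_iff]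
  have hint : IntegrableOn (fun t : ℝ => C ^ 2 / h ^ 2 * t ^ ((d : ℝ) / 2 - 1)) (Ioo 0 1) :=
    ((intervalIntegral.integrableOn_Ioo_rpow_iff one_pos).2 (by linarith)).const_mul _
  refine Integrable.mono' hint ?_ ?_
  · refine AEStronglyMeasurable.mul ?_ (hmeas.pow 2)
    exact (by fun_prop : Measurable fun t : ℝ => t ^ ((d : ℝ) / 2 + m - 1)).aestronglyMeasurable
  · filter_upwards [ae_restrict_mem measurableSet_Ioo] with t ht
    have hr : Real.sqrt t ∈ Ioo (0 : ℝ) 1 :=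
      ⟨Real.sqrt_pos.2 ht.1, by rw [Real.sqrt_lt' one_pos]; simpa using ht.2⟩
    have h1 := hfG _ hr
    rw [Real.sq_sqrt ht.1.le] at h1
    have h2 : G t ^ 2 * (t ^ m * h ^ 2) = f (Real.sqrt t) ^ 2 := by
      rw [h1, mul_pow, mul_pow, ← pow_mul, mul_comm m 2, pow_mul, Real.sq_sqrt ht.1.le]
    have h3 : f (Real.sqrt t) ^ 2 ≤ C ^ 2 := by
      have := hC _ (Ioo_subset_Icc_self hr)
      rw [Real.norm_eq_abs] at this
      exact sq_le_sq' (abs_le.1 this).1 (abs_le.1 this).2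
    have h4 : t ^ ((d : ℝ) / 2 + m - 1) = t ^ ((d : ℝ) / 2 - 1) * t ^ m := by
      rw [← Real.rpow_natCast, ← Real.rpow_add ht.1]
      congr 1
      ring
    have h5 := Real.rpow_pos_of_pos ht.1 ((d : ℝ) / 2 - 1)
    rw [Real.norm_of_nonneg (by have := ht.1.le; positivity), h4, div_mul_eq_mul_div,
      le_div_iff₀ (by positivity)]
    calc _ = t ^ ((d : ℝ) / 2 - 1) * (G t ^ 2 * (t ^ m * h ^ 2)) := by ring
      _ ≤ t ^ ((d : ℝ) / 2 - 1) * C ^ 2 := by rw [h2]; gcongr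
      _ = _ := by ring

/-- The flux `2 h t ^ b G'(t)` at `t = r ^ 2`, in terms of the profile along a ray. -/
theorem flux_eq (hd : 1 ≤ d) {r : ℝ} (hr : r ∈ Ioo (0 : ℝ) 1)
    (hfd : HasDerivAt f (f' r) r)
    (hfG : ∀ r ∈ Ioo (0 : ℝ) 1, f r = G (r ^ 2) * (r ^ m * h))
    (hG : HasDerivAt G (G₁ (r ^ 2)) (r ^ 2)) :
    2 * h * ((r ^ 2) ^ ((d : ℝ) / 2 + m) * G₁ (r ^ 2))
      = r ^ (d + m - 1) * f' r - m * (r ^ (d + m - 1) * (f r / r)) := by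
  have hr0 : r ≠ 0 := hr.1.ne'
  have h1 : HasDerivAt (fun r => G (r ^ 2) * (r ^ m * h))
      (G₁ (r ^ 2) * (2 * r) * (r ^ m * h) + G (r ^ 2) * (m * r ^ (m - 1) * h)) r := by
    have e1 : HasDerivAt (fun r => G (r ^ 2)) (G₁ (r ^ 2) * (2 * r)) r :=
      by
      have e0 : HasDerivAt (fun r : ℝ => r ^ 2) (2 * r) r := by simpa using hasDerivAt_pow 2 r
      exact HasDerivAt.comp (h₂ := G) (h := fun r : ℝ => r ^ 2) r hG e0
    exact e1.mul ((hasDerivAt_pow m r).mul_const h)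
  have h2 : f =ᶠ[𝓝 r] fun r => G (r ^ 2) * (r ^ m * h) := by
    filter_upwards [isOpen_Ioo.mem_nhds hr] with s hs using hfG s hs
  have h3 := hfd.unique (h1.congr_of_eventuallyEq h2)
  have h4 : (r ^ 2) ^ ((d : ℝ) / 2 + m) = r ^ (d + m - 1) * (r * r ^ m) := by
    rw [← Real.rpow_natCast r 2, ← Real.rpow_mul hr.1.le, ← pow_succ', ← pow_add,
      ← Real.rpow_natCast]
    congr 1
    have : d + m - 1 + (m + 1) = d + 2 * m := by omega
    rw [this]
    push_cast
    ring
  have h5 : (m : ℝ) * r ^ (m - 1) = m * (r ^ m / r) := by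
    rcases m with _ | m
    · simp
    · rw [Nat.add_sub_cancel, pow_succ]; field_simp
  rw [h4, h3, hfG r hr, h5]
  field_simp
  ring

/-- For `m > 0` every term keeps a positive power of `r` or the factor `f r → 0`. For `m = 0` the
power can be `r ^ 0` (when `d = 1`), so `f' 0 = 0` is needed. -/
theorem tendsto_flux_zero (hd : 1 ≤ d) (hfc : ContinuousOn f (Icc 0 1))
    (hf'c : ContinuousOn f' (Icc 0 1)) (hf0 : m ≠ 0 → f 0 = 0) (hf'0 : m = 0 → f' 0 = 0) :
    Tendsto (fun r => r ^ (d + m - 1) * f' r - m * (r ^ (d + m - 1) * (f r / r))) (𝓝[>] 0)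
      (𝓝 0) := by
  have hsub : 𝓝[>] (0 : ℝ) ≤ 𝓝[Icc 0 1] 0 := by
    rw [← nhdsWithin_Ioo_eq_nhdsGT one_pos]
    exact nhdsWithin_mono _ Ioo_subset_Icc_self
  have h1 : Tendsto f (𝓝[>] 0) (𝓝 (f 0)) := (hfc 0 (by simp)).mono_left hsub
  have h2 : Tendsto f' (𝓝[>] 0) (𝓝 (f' 0)) := (hf'c 0 (by simp)).mono_left hsub
  have hid : ∀ k : ℕ, Tendsto (fun r : ℝ => r ^ k) (𝓝[>] 0) (𝓝 (0 ^ k)) := fun k =>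
    ((continuous_pow k).tendsto 0).mono_left nhdsWithin_le_nhds
  rcases Nat.eq_zero_or_pos m with rfl | hm
  · have h3 := (hid (d + 0 - 1)).mul h2
    rw [hf'0 rfl, mul_zero] at h3
    simpa using h3
  · rw [hf0 hm.ne'] at h1
    have h3 := (hid (d + m - 1)).mul h2
    rw [zero_pow (by omega), zero_mul] at h3
    have h4 := ((hid (d + m - 2)).mul h1).const_mul (m : ℝ)
    have h5 := h3.sub h4
    rw [mul_zero, mul_zero, sub_zero] at h5
    refine h5.congr' ?_
    filter_upwards [self_mem_nhdsWithin] with r hr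
    have hr0 : r ≠ 0 := (mem_Ioi.1 hr).ne'
    have : d + m - 1 = d + m - 2 + 1 := by omega
    rw [this, pow_succ]
    field_simp

/-- Green's formula for `G` and `t ^ n`. The boundary term vanishes at `1` through the factor `1 -
t`, and at `0` through `tendsto_flux_zero`. -/
theorem satisfiesMomentEquation_of_ray (hd : 1 ≤ d) (hh : h ≠ 0) (hfc : ContinuousOn f (Icc 0 1))
    (hf'c : ContinuousOn f' (Icc 0 1)) (hfd : ∀ r ∈ Ioo (0 : ℝ) 1, HasDerivAt f (f' r) r)
    (hf0 : m ≠ 0 → f 0 = 0) (hf'0 : m = 0 → f' 0 = 0)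
    (hfG : ∀ r ∈ Ioo (0 : ℝ) 1, f r = G (r ^ 2) * (r ^ m * h))
    (hG : ∀ t ∈ Ioo (0 : ℝ) 1, HasDerivAt G (G₁ t) t)
    (hG₁ : ∀ t ∈ Ioo (0 : ℝ) 1, HasDerivAt G₁ (G₂ t) t) {κ l : ℝ}
    (hode : ∀ t ∈ Ioo (0 : ℝ) 1, -4 * (t * (1 - t) * G₂ t
      + (((d : ℝ) / 2 + m) - ((d : ℝ) / 2 + m + 1) * t) * G₁ t) + κ * t * G t = l * G t) :
    SatisfiesMomentEquation (d / 2 + m) κ l G := by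
  have hd' : (1 : ℝ) ≤ d := by exact_mod_cast hd
  have hb : (0 : ℝ) < d / 2 + m := by positivity
  have hL2 : MemLp G 2 (jacobiMeasure (d / 2 + m)) :=
    memLp_of_ray hd hh hfc hfG fun t ht => (hG t ht).continuousAt.continuousWithinAt
  intro n
  set b : ℝ := d / 2 + m with hbdef
  have hi : ∀ k : ℕ, Integrable (fun t => t ^ k * G t) (jacobiMeasure b) := fun k =>
    integrable_pow_mul_jacobiMeasure hb k hL2
  set F : ℝ → ℝ := fun t => jacobiLower b n * (t ^ (n - 1) * G t) - κ * (t ^ (n + 1) * G t)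
    - (jacobiEigenvalue b n - l) * (t ^ n * G t) with hF
  have hFi : Integrable F (jacobiMeasure b) :=
    (((hi (n - 1)).const_mul _).sub ((hi (n + 1)).const_mul _)).sub ((hi n).const_mul _)
  suffices hF0 : ∫ t, F t ∂jacobiMeasure b = 0 by
    have h1 : ∫ t, F t ∂jacobiMeasure b = _ :=
      integral_sub (((hi (n - 1)).const_mul _).sub ((hi (n + 1)).const_mul _)) ((hi n).const_mul _)
    rw [integral_sub ((hi (n - 1)).const_mul _) ((hi (n + 1)).const_mul _), integral_const_mul,
      integral_const_mul, integral_const_mul] at h1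
    rw [h1] at hF0
    linear_combination -hF0
  -- The Lagrange bracket `4 t ^ b (1 - t) (p' G - p G')` with `p = t ^ n`.
  let W : ℝ → ℝ := fun t => 4 * ((1 - t) * (n * t ^ (n - 1) * (t ^ b * G t) - t ^ n * (t ^ b * G₁ t)))
  have hW : ∀ t ∈ Ioo (0 : ℝ) 1, HasDerivAt W (t ^ (b - 1) * F t) t := by
    intro t ht
    have e1 : HasDerivAt (fun t : ℝ => t ^ b) (b * t ^ (b - 1)) t :=
      Real.hasDerivAt_rpow_const (Or.inl ht.1.ne')
    have e2 : HasDerivAt (fun t : ℝ => t ^ (n - 1)) ((n - 1 : ℕ) * t ^ (n - 1 - 1)) t :=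
      hasDerivAt_pow _ _
    have e3 := ((e2.const_mul (n : ℝ)).mul (e1.mul (hG t ht))).sub
      ((hasDerivAt_pow n t).mul (e1.mul (hG₁ t ht)))
    have e4 := ((((hasDerivAt_id t).const_sub 1).mul e3).const_mul 4)
    refine e4.congr_deriv ?_
    have ht0 := ht.1.ne'
    have hp : t ^ b = t ^ (b - 1) * t := by
      rw [Real.rpow_sub_one ht0]; field_simp
    have hn1 : (n : ℝ) * t ^ n = n * t ^ (n - 1) * t := by
      rcases n with _ | n
      · simp
      · rw [Nat.add_sub_cancel, pow_succ]; ring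
    have hn2 : (n : ℝ) * ((n - 1 : ℕ) * t ^ (n - 1 - 1)) * t = n * (n - 1) * t ^ (n - 1) := by
      rcases n with _ | _ | n
      · simp
      · simp
      · simp only [Nat.add_sub_cancel]
        push_cast
        ring
    have ho := hode t ht
    simp only [hF, jacobiLower, jacobiEigenvalue, Pi.mul_apply, Pi.sub_apply, id, hp]
    linear_combination 4 * (1 - t) * t ^ (b - 1) * G t * hn2
      + 4 * (n + b) * t ^ (b - 1) * G t * hn1 + t ^ n * t ^ (b - 1) * ho
  have hcov : ∀ t ∈ Ioo (0 : ℝ) 1, Real.sqrt t ∈ Ioo (0 : ℝ) 1 ∧ Real.sqrt t ^ 2 = t := fun t ht =>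
    ⟨⟨Real.sqrt_pos.2 ht.1, by rw [Real.sqrt_lt' one_pos]; simpa using ht.2⟩, Real.sq_sqrt ht.1.le⟩
  -- At `r = √t`, `Q` and `A` are `t ^ b G'` and `t ^ b G` written through `f` and `f'`, whose
  -- continuity on `[0, 1]` controls both endpoints.
  set Q : ℝ → ℝ := fun r => (2 * h)⁻¹ *
    (r ^ (d + m - 1) * f' r - m * (r ^ (d + m - 1) * (f r / r))) with hQ
  set A : ℝ → ℝ := fun r => h⁻¹ * (r ^ (d + m) * f r) with hA
  have hWeq : ∀ t ∈ Ioo (0 : ℝ) 1,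
      4 * ((1 - t) * (n * t ^ (n - 1) * A (Real.sqrt t) - t ^ n * Q (Real.sqrt t))) = W t := by
    intro t ht
    obtain ⟨hr, hr2⟩ := hcov t ht
    have h1 := flux_eq hd hr (hfd _ hr) hfG (by rw [hr2]; exact hG t ht)
    have hQt : Q (Real.sqrt t) = t ^ b * G₁ t := by
      rw [hQ]
      dsimp only
      rw [← h1, hr2, ← hbdef]
      field_simp
    have hAt : A (Real.sqrt t) = t ^ b * G t := by
      have h2 : t ^ b = Real.sqrt t ^ (d + m) * Real.sqrt t ^ m := by
        rw [← pow_add, ← Real.rpow_natCast, Real.sqrt_eq_rpow, ← Real.rpow_mul ht.1.le]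
        congr 1
        rw [hbdef]
        push_cast
        ring
      rw [hA]
      dsimp only
      rw [hfG _ hr, hr2, h2]
      field_simp
    rw [hQt, hAt]
  have hsqrt0 : Tendsto Real.sqrt (𝓝[>] 0) (𝓝[>] 0) := by
    refine tendsto_nhdsWithin_iff.2 ⟨?_, ?_⟩
    · have := (Real.continuous_sqrt.tendsto 0).mono_left (nhdsWithin_le_nhds (s := Ioi 0))
      simpa using this
    · filter_upwards [self_mem_nhdsWithin] with t ht using Real.sqrt_pos.2 ht
  have hsqrt1 : Tendsto Real.sqrt (𝓝[<] 1) (𝓝[Icc 0 1] 1) := by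
    refine tendsto_nhdsWithin_iff.2 ⟨?_, ?_⟩
    · have := (Real.continuous_sqrt.tendsto 1).mono_left (nhdsWithin_le_nhds (s := Iio 1))
      simpa using this
    · rw [← nhdsWithin_Ioo_eq_nhdsLT zero_lt_one]
      filter_upwards [self_mem_nhdsWithin] with t ht using Ioo_subset_Icc_self (hcov t ht).1
  have hsub : 𝓝[>] (0 : ℝ) ≤ 𝓝[Icc 0 1] 0 := by
    rw [← nhdsWithin_Ioo_eq_nhdsGT one_pos]
    exact nhdsWithin_mono _ Ioo_subset_Icc_self
  have hpoly : ∀ p : ℝ → ℝ, Continuous p → ∀ (x : ℝ) (s : Set ℝ), Tendsto p (𝓝[s] x) (𝓝 (p x)) :=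
    fun p hp x s => (hp.tendsto x).mono_left nhdsWithin_le_nhds
  have hlim0 : Tendsto W (𝓝[>] 0) (𝓝 0) := by
    have hQ0 : Tendsto (fun t => Q (Real.sqrt t)) (𝓝[>] 0) (𝓝 0) := by
      have := ((tendsto_flux_zero hd hfc hf'c hf0 hf'0).const_mul (2 * h)⁻¹).comp hsqrt0
      rw [mul_zero] at this
      exact this
    have hA0 : Tendsto (fun t => A (Real.sqrt t)) (𝓝[>] 0) (𝓝 0) := by
      have h1 : Tendsto f (𝓝[>] 0) (𝓝 (f 0)) := (hfc 0 (by simp)).mono_left hsub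
      have := (((hpoly (fun r => r ^ (d + m)) (by fun_prop) 0 (Ioi 0)).mul h1).const_mul h⁻¹).comp
        hsqrt0
      rw [zero_pow (by omega), zero_mul, mul_zero] at this
      exact this
    have h1 := ((((hpoly (fun t => n * t ^ (n - 1)) (by fun_prop) 0 (Ioi 0)).mul hA0).sub
      ((hpoly (fun t => t ^ n) (by fun_prop) 0 (Ioi 0)).mul hQ0)))
    have h2 := ((hpoly (fun t => 1 - t) (by fun_prop) 0 (Ioi 0)).mul h1).const_mul 4
    simp only [mul_zero, sub_zero] at h2
    refine h2.congr' ?_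
    rw [← nhdsWithin_Ioo_eq_nhdsGT one_pos]
    filter_upwards [self_mem_nhdsWithin] with t ht using hWeq t ht
  have hlim1 : Tendsto W (𝓝[<] 1) (𝓝 0) := by
    have h1 : Tendsto f (𝓝[Icc 0 1] 1) (𝓝 (f 1)) := hfc 1 (by simp)
    have h2 : Tendsto f' (𝓝[Icc 0 1] 1) (𝓝 (f' 1)) := hf'c 1 (by simp)
    have hp := hpoly (fun r => r ^ (d + m - 1)) (by fun_prop) 1 (Icc 0 1)
    have hinv : Tendsto (fun r : ℝ => r) (𝓝[Icc 0 1] 1) (𝓝 1) :=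
      hpoly (fun r => r) continuous_id 1 (Icc 0 1)
    have hQ1 := (((hp.mul h2).sub ((hp.mul (h1.div hinv one_ne_zero)).const_mul (m : ℝ))).const_mul
      (2 * h)⁻¹).comp hsqrt1
    have hA1 := (((hpoly (fun r => r ^ (d + m)) (by fun_prop) 1 (Icc 0 1)).mul h1).const_mul
      h⁻¹).comp hsqrt1
    have h3 := ((((hpoly (fun t => n * t ^ (n - 1)) (by fun_prop) 1 (Iio 1)).mul hA1).sub
      ((hpoly (fun t => t ^ n) (by fun_prop) 1 (Iio 1)).mul hQ1)))
    have h4 := ((hpoly (fun t => 1 - t) (by fun_prop) 1 (Iio 1)).mul h3).const_mul 4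
    simp only [sub_self, zero_mul, mul_zero] at h4
    refine h4.congr' ?_
    rw [← nhdsWithin_Ioo_eq_nhdsLT zero_lt_one]
    filter_upwards [self_mem_nhdsWithin] with t ht using hWeq t ht
  have hint : IntervalIntegrable (fun t => t ^ (b - 1) * F t) volume 0 1 := by
    rw [intervalIntegrable_iff_integrableOn_Ioo_of_le zero_le_one]
    exact integrable_jacobiMeasure_iff.1 hFi
  have := intervalIntegral.integral_eq_sub_of_hasDerivAt_of_tendsto zero_lt_one hW hint hlim0 hlim1
  rw [integral_jacobiMeasure, ← integral_Ioc_eq_integral_Ioo,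
    ← intervalIntegral.integral_of_le zero_le_one, this, sub_zero]

end Radial

variable {d m : ℕ}

theorem exists_unit_eval_ne_zero (hd : 1 ≤ d) {P : MvPolynomial (Fin d) ℝ}
    (hP : P.IsHomogeneous m) {x : EuclideanSpace ℝ (Fin d)}
    (hx : MvPolynomial.eval (fun i => x i) P ≠ 0) :
    ∃ e : EuclideanSpace ℝ (Fin d), ‖e‖ = 1 ∧ MvPolynomial.eval (fun i => e i) P ≠ 0 := by
  rcases eq_or_ne x 0 with rfl | hx0
  · refine ⟨EuclideanSpace.single ⟨0, hd⟩ 1, by simp, fun h => hx ?_⟩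
    have := eval_smul_of_isHomogeneous hP 0
      fun i => (EuclideanSpace.single (⟨0, hd⟩ : Fin d) (1 : ℝ)) i
    rw [h, mul_zero] at this
    simpa using this
  · refine ⟨‖x‖⁻¹ • x, by
      rw [norm_smul, norm_inv, norm_norm, inv_mul_cancel₀ (norm_ne_zero_iff.2 hx0)], ?_⟩
    have : MvPolynomial.eval (fun i => (‖x‖⁻¹ • x) i) P = _ :=
      eval_smul_of_isHomogeneous hP ‖x‖⁻¹ fun i => x i
    rw [this]
    exact mul_ne_zero (pow_ne_zero _ (inv_ne_zero (norm_ne_zero_iff.2 hx0))) hx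

/-- Eigenvalues of the operator on the ball are eigenvalues of the moment equation. -/
theorem momentEquation_of_mem_eigenvalues (hd : 1 ≤ d) {c χ : ℝ} (hχ : χ ∈ eigenvalues d m c) :
    ∃ v, MemLp v 2 (jacobiMeasure (d / 2 + m)) ∧ ¬ v =ᵐ[jacobiMeasure (d / 2 + m)] 0 ∧
      SatisfiesMomentEquation (d / 2 + m) (c ^ 2) (χ - m * (m + d)) v := by
  obtain ⟨ψ, hψC, ⟨φ, P, hP, hsep⟩, ⟨x₀, hx₀, hψ0⟩, heig⟩ := hχ
  have hP0 : MvPolynomial.eval (fun i => x₀ i) P ≠ 0 := by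
    rw [hsep x₀ hx₀] at hψ0
    exact right_ne_zero_of_mul hψ0
  obtain ⟨e, he, hPe⟩ := exists_unit_eval_ne_zero hd hP.1 hP0
  set h := MvPolynomial.eval (fun i => e i) P with hh
  set f : ℝ → ℝ := fun r => ψ (r • e) with hf
  -- The ray is extended to a full diameter so that the derivative at `0` is two-sided.
  set f' : ℝ → ℝ := derivWithin f (Icc (-1) 1) with hf'
  set G : ℝ → ℝ := fun t => φ (2 * t - 1) with hG
  have hnorm : ∀ r : ℝ, ‖r • e‖ = |r| := fun r => by rw [norm_smul, he, mul_one, Real.norm_eq_abs]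
  have hball : ∀ r ∈ Icc (-1 : ℝ) 1, r • e ∈ Metric.closedBall (0 : EuclideanSpace ℝ (Fin d)) 1 :=
    fun r hr => by rw [mem_closedBall_zero_iff, hnorm]; exact abs_le.2 hr
  have heval : ∀ r : ℝ, MvPolynomial.eval (fun i => (r • e) i) P = r ^ m * h := fun r =>
    eval_smul_of_isHomogeneous hP.1 r fun i => e i
  have hfφ : ∀ r ∈ Icc (-1 : ℝ) 1, f r = G (r ^ 2) * (r ^ m * h) := fun r hr => by
    simp only [hf, hG]
    rw [hsep _ (hball r hr), hnorm, sq_abs, heval]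
  have hfC : ContDiffOn ℝ 2 f (Icc (-1) 1) := by
    refine hψC.comp (contDiff_id.smul contDiff_const).contDiffOn hball
  have hf'C : ContinuousOn f' (Icc (-1) 1) :=
    hfC.continuousOn_derivWithin (uniqueDiffOn_Icc (by norm_num)) (by norm_num)
  have hfd : ∀ r ∈ Ioo (-1 : ℝ) 1, HasDerivAt f (f' r) r := fun r hr =>
    ((hfC.differentiableOn (by norm_num)) r (Ioo_subset_Icc_self hr)).hasDerivWithinAt.hasDerivAt
      (Icc_mem_nhds hr.1 hr.2)
  have hsub : Icc (0 : ℝ) 1 ⊆ Icc (-1) 1 := Icc_subset_Icc (by norm_num) le_rfl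
  have hsub' : Ioo (0 : ℝ) 1 ⊆ Ioo (-1) 1 := Ioo_subset_Ioo (by norm_num) le_rfl
  have hcov : ∀ t ∈ Ioo (0 : ℝ) 1, Real.sqrt t ∈ Ioo (0 : ℝ) 1 ∧ Real.sqrt t ^ 2 = t := fun t ht =>
    ⟨⟨Real.sqrt_pos.2 ht.1, by rw [Real.sqrt_lt' one_pos]; simpa using ht.2⟩, Real.sq_sqrt ht.1.le⟩
  -- No regularity of `φ` is assumed; it is recovered by dividing `f (√t)` by the nonvanishing
  -- angular factor.
  have hGC : ContDiffOn ℝ 2 G (Ioo 0 1) := by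
    have h1 : ContDiffOn ℝ 2 (fun t => f (Real.sqrt t) / (Real.sqrt t ^ m * h)) (Ioo 0 1) := by
      have hs : ContDiffOn ℝ 2 Real.sqrt (Ioo 0 1) := fun t ht =>
        (Real.contDiffAt_sqrt ht.1.ne').contDiffWithinAt
      refine ContDiffOn.div (hfC.comp hs fun t ht =>
        Ioo_subset_Icc_self (hsub' (hcov t ht).1)) ((hs.pow m).mul contDiffOn_const) ?_
      intro t ht
      exact mul_ne_zero (pow_ne_zero _ (hcov t ht).1.1.ne') hPe
    refine h1.congr fun t ht => ?_
    obtain ⟨hr, hr2⟩ := hcov t ht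
    have hr0 : Real.sqrt t ^ m ≠ 0 := pow_ne_zero _ hr.1.ne'
    rw [hfφ _ (Ioo_subset_Icc_self (hsub' hr)), hr2]
    field_simp
  have hG₁C : ContDiffOn ℝ 1 (deriv G) (Ioo 0 1) :=
    hGC.deriv_of_isOpen isOpen_Ioo (by norm_num)
  have hGd : ∀ t ∈ Ioo (0 : ℝ) 1, HasDerivAt G (deriv G t) t := fun t ht =>
    ((hGC.differentiableOn (by norm_num)).differentiableAt (isOpen_Ioo.mem_nhds ht)).hasDerivAt
  have hG₁d : ∀ t ∈ Ioo (0 : ℝ) 1, HasDerivAt (deriv G) (deriv (deriv G) t) t := fun t ht =>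
    ((hG₁C.differentiableOn (by norm_num)).differentiableAt (isOpen_Ioo.mem_nhds ht)).hasDerivAt
  have hfG : ∀ r ∈ Ioo (0 : ℝ) 1, f r = G (r ^ 2) * (r ^ m * h) := fun r hr =>
    hfφ r (Ioo_subset_Icc_self (hsub' hr))
  have hode : ∀ t ∈ Ioo (0 : ℝ) 1, -4 * (t * (1 - t) * deriv (deriv G) t
      + (((d : ℝ) / 2 + m) - ((d : ℝ) / 2 + m + 1) * t) * deriv G t) + c ^ 2 * t * G t
      = (χ - m * (m + d)) * G t := by
    intro t ht
    obtain ⟨hr, hr2⟩ := hcov t ht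
    set r := Real.sqrt t
    have hnr : ‖r • e‖ ^ 2 = t := by rw [hnorm, sq_abs, hr2]
    have hmem : r • e ∈ Metric.ball (0 : EuclideanSpace ℝ (Fin d)) 1 := by
      rw [mem_ball_zero_iff, hnorm, abs_of_pos hr.1]
      exact hr.2
    have hloc : ψ =ᶠ[𝓝 (r • e)] radialMul G P := by
      filter_upwards [Metric.isOpen_ball.mem_nhds hmem] with y hy
      exact hsep y (Metric.ball_subset_closedBall hy)
    have h1 := sturmLiouville_radialMul (c := c) hP hloc (G₁ := deriv G) (g₂ := deriv (deriv G) t)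
      (by rw [hnr]; filter_upwards [isOpen_Ioo.mem_nhds ht] with s hs using hGd s hs)
      (by rw [hnr]; exact hG₁d t ht)
    rw [heig _ hmem, hloc.self_of_nhds, radialMul, hnr] at h1
    have hne : MvPolynomial.eval (fun i => (r • e) i) P ≠ 0 := by
      rw [heval]
      exact mul_ne_zero (pow_ne_zero _ hr.1.ne') hPe
    apply mul_right_cancel₀ hne
    linear_combination -h1
  have hf0 : m ≠ 0 → f 0 = 0 := fun hm => by
    rw [hfφ 0 (by norm_num), zero_pow hm, zero_mul, mul_zero]
  -- For `m = 0`, `f` is even.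
  have hf'0 : m = 0 → f' 0 = 0 := by
    intro hm
    have h1 : HasDerivAt f (f' 0) 0 := hfd 0 (by norm_num)
    have h2 : HasDerivAt (fun r => f (-r)) (-f' 0) 0 := by
      have h3 : HasDerivAt f (f' 0) (-0) := by rwa [neg_zero]
      exact (HasDerivAt.comp (h₂ := f) (h := fun r => -r) 0 h3 (hasDerivAt_neg 0)).congr_deriv
        (by ring)
    have h4 : f =ᶠ[𝓝 0] fun r => f (-r) := by
      filter_upwards [Icc_mem_nhds (show (-1 : ℝ) < 0 by norm_num) (show (0 : ℝ) < 1 by norm_num)]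
        with r hr
      rw [hfφ r hr, hfφ (-r) ⟨by linarith [hr.2], by linarith [hr.1]⟩, hm]
      simp
    have := h1.unique (h2.congr_of_eventuallyEq h4)
    linarith
  have hL2 := memLp_of_ray hd hPe (hfC.continuousOn.mono hsub) hfG hGC.continuousOn
  refine ⟨G, hL2, fun hae => ?_, satisfiesMomentEquation_of_ray hd hPe
    (hfC.continuousOn.mono hsub) (hf'C.mono hsub) (fun r hr => hfd r (hsub' hr)) hf0 hf'0 hfG hGd
    hG₁d hode⟩
  have hG0 : EqOn G 0 (Ioo 0 1) := by
    refine Measure.eqOn_open_of_ae_eq (μ := volume) ?_ isOpen_Ioo hGC.continuousOn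
      continuousOn_const
    have := ae_volume_of_ae_jacobiMeasure hae
    exact (ae_restrict_iff' measurableSet_Ioo).2 this
  have hf00 : EqOn f 0 (Icc 0 1) := by
    have h1 : EqOn f 0 (Ioo 0 1) := fun r hr => by
      rw [hfG r hr, hG0 ⟨by have := hr.1; positivity, by nlinarith [hr.1, hr.2]⟩]
      simp
    refine h1.of_subset_closure (hfC.continuousOn.mono hsub) continuousOn_const
      Ioo_subset_Icc_self ?_
    rw [closure_Ioo (by norm_num)]
  have hx₀' : ‖x₀‖ ∈ Icc (0 : ℝ) 1 := ⟨norm_nonneg _, by simpa using hx₀⟩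
  have h2 := hf00 hx₀'
  -- At the origin `r ^ m` may vanish, so `G` cannot be recovered there; but `f 0` is `ψ 0` itself,
  -- already zero by continuity.
  rcases eq_or_ne x₀ 0 with rfl | hne
  · apply hψ0
    simpa [hf] using h2
  · rw [hfφ _ (hsub hx₀')] at h2
    have h3 : G (‖x₀‖ ^ 2) = 0 := by
      refine (mul_eq_zero.1 h2).resolve_right (mul_ne_zero (pow_ne_zero _ ?_) hPe)
      exact norm_ne_zero_iff.2 hne
    apply hψ0
    rw [hsep x₀ hx₀]
    simp only [hG] at h3
    rw [h3, zero_mul]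

end BallPSWF

theorem mainTheorem7 (d m : ℕ) (hd : 1 ≤ d) (hm : d = 1 → m ≤ 1) (c : ℝ) (hc : 0 < c) :
    ∃ χ : ℕ → ℝ, StrictMono χ ∧ Set.range χ = BallPSWF.eigenvalues d m c ∧
      ∀ k : ℕ,
        ((m : ℝ) + 2 * k) * (m + 2 * k + d) ≤ χ k ∧
        χ k ≤ ((m : ℝ) + 2 * k) * (m + 2 * k + d) + c ^ 2 := by
  have hd' : (1 : ℝ) ≤ d := by exact_mod_cast hd
  have hb : (0 : ℝ) < d / 2 + m := by positivity
  obtain ⟨l, hl, hr, hlk⟩ := exists_strictMono_momentEigenvalues hb (by positivity : 0 < c ^ 2)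
  -- The shift is the zeroth-order term of the radial operator; it turns `4 k (k + d/2 + m)` into
  -- `(m + 2k) (m + 2k + d)`.
  refine ⟨fun k => l k + m * (m + d), fun i j hij => by simpa using hl hij, ?_, fun k => ?_⟩
  · ext χ
    constructor
    · rintro ⟨k, rfl⟩
      obtain ⟨v, hv, hv0, hvm⟩ : l k ∈ _ := hr ▸ mem_range_self k
      refine BallPSWF.mem_eigenvalues_of_momentEquation hd hm hc hv hv0 ?_
      simpa using hvm
    · intro hχ
      have : χ - m * (m + d) ∈ range l := by
        rw [hr]
        exact BallPSWF.momentEquation_of_mem_eigenvalues hd hχ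
      obtain ⟨k, hk⟩ := this
      exact ⟨k, by simp [hk]⟩
  · obtain ⟨h1, h2⟩ := hlk k
    simp only [jacobiEigenvalue] at h1 h2
    constructor <;> linarith
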